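/- Let $\tau\in(2,3)$, $\gamma\in(0,1)$, $C>0$, and let $F$ be the distribution function of a probability law on $\mathbb N$ with $F(1)=0$ such that, for all sufficiently large $x$, $$x^{-\tau+1-C(\log x)^{\gamma-1}}\le 1-F(x)\le x^{-\tau+1+C(\log x)^{\gamma-1}}.$$ Let $p:\mathbb N\to[0,1]$ be non-increasing and suppose that, for some constants $b,c>0$ and $\gamma'<1$, $$p(d)>b\exp\{-c(\log d)^{\gamma'}\}\qquad\text{for all } d\ge 2 .$$ For $n\ge1$ let $\boldsymbol d=(d_1,\dots,d_n)$ be i.i.d. with distribution function $F$, where $d_n$ is increased by $1$ if the sum is odd, and let $\mathcal L_n=\sum_{i\in[n]}d_i$ (after this correction). Attach $d_i$ half-edges to vertex $i$. Independently for all half-edges, a half-edge attached to a vertex of degree $d$ is retained (and called regular) with probability $p(d)$; otherwise it is detached from its vertex and becomes the single half-edge of a new artificial vertex. Then pair the $\mathcal L_n$ half-edges (regular and artificial) uniformly at random, and remove the artificial vertices with their half-edges and edges. Let $d_i^{rr}$ be the resulting degree of vertex $i$, that is, the number of regular half-edges of $i$ that are paired to a regular half-edge, and let $F_n^{rr}(x)=\frac1n\#\{i\in[n]:d_i^{rr}\le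 x\}$. Then there exist constants $\alpha>\frac12$, $x_0>1$, $c_1>0$, $C_1>0$ and $\beta>0$, not depending on $n$, such that, with probability tending to $1$ as $n\to\infty$, both $$1-F_n^{rr}(x)\ge \frac{c_1}{x^{\tau-1+C_1(\log x)^{\max\{\gamma,\gamma'\}-1}}}\qquad\text{for all real } x\in[x_0,n^\alpha)$$ and $\mathcal L_n\le \beta n$ hold. -/

import Mathlib

open Filter Topology MeasureTheory ProbabilityTheory
open scoped ENNReal

namespace DegreePercolation

noncomputable section

/-! ### Degree distributions -/

/-- The cumulative distribution function `F(x) = ℙ(D ≤ x)` of a law `ν` on the natural numbers. -/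
def degreeCDF (ν : Measure ℕ) (x : ℝ) : ℝ := ν.real {k : ℕ | (k : ℝ) ≤ x}

/-- The empirical distribution function `F_n(x) = #{i ∈ [n] : d_i ≤ x} / n` of a degree
sequence. -/
def empiricalCDF {n : ℕ} (d : Fin n → ℕ) (x : ℝ) : ℝ :=
  ((Finset.univ.filter fun i : Fin n => (d i : ℝ) ≤ x).card : ℝ) / n

/-- The power-law condition: for all large `x`,
`x ^ (-τ + 1 - C (log x) ^ (γ - 1)) ≤ 1 - F(x) ≤ x ^ (-τ + 1 + C (log x) ^ (γ - 1))`. -/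
def PowerLaw (F : ℝ → ℝ) (τ γ C : ℝ) : Prop :=
  ∀ᶠ x : ℝ in atTop,
    x ^ (-τ + 1 - C * Real.log x ^ (γ - 1)) ≤ 1 - F x ∧
      1 - F x ≤ x ^ (-τ + 1 + C * Real.log x ^ (γ - 1))

/-- The law of `n` i.i.d. degrees with common law `ν`. -/
def iidDegrees (ν : Measure ℕ) [IsProbabilityMeasure ν] (n : ℕ) : PMF (Fin n → ℕ) :=
  (Measure.pi fun _ : Fin n => ν).toPMF

/-- The total degree of a degree sequence. -/
def totalDegree {n : ℕ} (d : Fin n → ℕ) : ℕ := ∑ i, d i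

/-- If the total degree is odd, one half-edge is added to the last vertex. -/
def evenDegrees {n : ℕ} (d : Fin n → ℕ) : Fin n → ℕ := fun i =>
  if Odd (totalDegree d) ∧ (i : ℕ) + 1 = n then d i + 1 else d i

/-! ### Half-edges, their pairing and their percolation -/

/-- The half-edges of a degree sequence: `d i` of them at the vertex `i`. A half-edge that is not
retained is detached from its vertex and becomes the only half-edge of a new artificial vertex;
it keeps its label, so that the same type also labels the half-edges after percolation. -/
abbrev HalfEdge {n : ℕ} (d : Fin n → ℕ) : Type := Σ i : Fin n, Fin (d i)

/-- The pairings of a finite set of half-edges, encoded as fixed-point-free involutions: `σ s` is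
the half-edge that `s` is paired to. -/
def pairings (α : Type) [Fintype α] [DecidableEq α] : Finset (Equiv.Perm α) :=
  Finset.univ.filter fun σ => ∀ s, σ s ≠ s ∧ σ (σ s) = s

theorem pairings_nonempty {α : Type} [Fintype α] [DecidableEq α] (h : Even (Fintype.card α)) :
    (pairings α).Nonempty := by
  obtain ⟨k, hk⟩ := h
  let e : α ≃ Fin k × Bool := Fintype.equivOfCardEq (by
    rw [hk, Fintype.card_prod, Fintype.card_fin, Fintype.card_bool]; omega)
  refine ⟨(e.trans ((Equiv.refl (Fin k)).prodCongr Equiv.boolNot)).trans e.symm, ?_⟩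
  simp only [pairings, Finset.mem_filter, Finset.mem_univ, true_and]
  intro s
  constructor
  · intro h
    have h2 := congrArg (fun t => (e t).2) h
    simp at h2
  · have hb : ∀ t : Fin k × Bool,
        Prod.map id (⇑Equiv.boolNot) (Prod.map id (⇑Equiv.boolNot) t) = t := by
      rintro ⟨a, b⟩
      cases b <;> rfl
    simp [hb]

theorem card_halfEdge {n : ℕ} (d : Fin n → ℕ) : Fintype.card (HalfEdge d) = totalDegree d := by
  simp [totalDegree]

theorem even_totalDegree_evenDegrees {n : ℕ} (d : Fin n → ℕ) :
    Even (totalDegree (evenDegrees d)) := by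
  by_cases h : Odd (totalDegree d)
  · obtain _ | m := n
    · simp [totalDegree]
    · have h' := h
      unfold totalDegree at h'
      rw [Fin.sum_univ_castSucc] at h'
      have h1 : ∀ i : Fin m, evenDegrees d i.castSucc = d i.castSucc := by
        intro i
        have := i.isLt
        simp only [evenDegrees, Fin.val_castSucc]
        rw [if_neg]
        omega
      have h2 : evenDegrees d (Fin.last m) = d (Fin.last m) + 1 := by
        simp [evenDegrees, h]
      rw [totalDegree, Fin.sum_univ_castSucc, h2, Finset.sum_congr rfl fun i _ => h1 i, ← add_assoc]
      exact h'.add_one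
  · have h1 : evenDegrees d = d := by
      funext i
      simp [evenDegrees, h]
    rw [h1]
    exact Nat.not_odd_iff_even.mp h

theorem pairings_evenDegrees_nonempty {n : ℕ} (d : Fin n → ℕ) :
    (pairings (HalfEdge (evenDegrees d))).Nonempty :=
  pairings_nonempty (by rw [card_halfEdge]; exact even_totalDegree_evenDegrees d)

/-- Half-edge percolation: every half-edge `s` at a vertex of degree `d_{v(s)}` is retained
(`true`, it stays regular) with probability `p (d_{v(s)})`, independently of all others. -/
def retention {n : ℕ} (d : Fin n → ℕ) (p : ℕ → unitInterval) : PMF (HalfEdge d → Bool) :=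
  (Measure.pi fun s : HalfEdge d => bernoulliMeasure true false (p (d s.1))).toPMF

/-- The number of regular half-edges of the vertex `i` that are paired to a regular half-edge,
that is, the degree of `i` once the artificial vertices and their edges are removed. -/
def rrDegree {n : ℕ} (d : Fin n → ℕ) (keep : HalfEdge d → Bool) (σ : Equiv.Perm (HalfEdge d)) :
    Fin n → ℕ := fun i =>
  (Finset.univ.filter fun j : Fin (d i) => keep ⟨i, j⟩ = true ∧ keep (σ ⟨i, j⟩) = true).card

/-- The joint law of the degree sequences `(d, d^{rr})` before and after percolation:
take i.i.d. degrees (with total made even), percolate the half-edges, then pair all half-edges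
(regular and artificial) uniformly at random, independently of the percolation. -/
def percolatedLaw (ν : Measure ℕ) [IsProbabilityMeasure ν] (p : ℕ → unitInterval) (n : ℕ) :
    PMF ((Fin n → ℕ) × (Fin n → ℕ)) :=
  (iidDegrees ν n).bind fun d₀ =>
    (retention (evenDegrees d₀) p).bind fun keep =>
      (PMF.uniformOfFinset (pairings (HalfEdge (evenDegrees d₀)))
        (pairings_evenDegrees_nonempty d₀)).map fun σ =>
          (evenDegrees d₀, rrDegree (evenDegrees d₀) keep σ)

end

end DegreePercolation

namespace DegreePercolation

/-! It suffices to treat thresholds `x = exp k`, and no single vertex needs to be followed: an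
averaging argument and Chebyshev bounds are enough. Take the set `W` of vertices with degree in a
window `(Y, M + 1]` a little above `x`, and the set `V` of vertices of bounded degree, which has
linear size and retention bounded below. Many half-edges of `W` and of `V` are retained, and in a
uniform pairing at least half of the expected number of retained `W`-half-edges meet retained
`V`-half-edges (`card_pairings_filter_lt_le`). If `Y` exceeds `x` by enough to pay for the retention
probability, this number is at least `2 * x * |W|`. Vertices of `W` with final degree at most `x`
account for at most `x * |W|` of it, and the others for at most `M + 1` each, so at least `x * |W| /
(M + 1)` vertices end above `x` (`percolatedLaw_card_lt_le`).

With `x = exp s`, both ends of the window are `exp (s + O(s ^ κ))`, `κ = max γ γ'`, so every loss is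
a factor `exp (O(s ^ κ))`, which is the allowed correction of the exponent
(`PowerLaw.exists_scales`). One scale fails with probability of order `1 / (n q φ)`, where `q` is
the mass of the window and `φ` the retention there; `q φ` is at least of order `x ^ (-(τ - 1 + η))`.
As `τ < 3`, this is a negative power of `n` up to `x = n ^ α` for some `α > 1/2`, and a union bound
over `O(log n)` scales finishes. As `τ > 2`, degrees have finite mean, which makes the total degree
linear. -/

/-! ### Two-stage experiments and a Chebyshev bound for independent indicators. -/

theorem toOuterMeasure_bind_le {α β : Type*} (p : PMF α) (f : α → PMF β) (G : Set α) (S : Set β)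
    (e : ℝ≥0∞) (h : ∀ a ∈ G, (f a).toOuterMeasure S ≤ e) :
    (p.bind f).toOuterMeasure S ≤ p.toOuterMeasure Gᶜ + e := by
  rw [PMF.toOuterMeasure_bind_apply, PMF.toOuterMeasure_apply]
  calc ∑' a, p a * (f a).toOuterMeasure S
      ≤ ∑' a, (Gᶜ.indicator p a + p a * e) := by
        refine ENNReal.tsum_le_tsum fun a => ?_
        by_cases ha : a ∈ G
        · simp only [Set.mem_compl_iff, ha, not_true_eq_false, not_false_eq_true,
            Set.indicator_of_notMem, zero_add]
          gcongr
          exact h a ha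
        · rw [Set.indicator_of_mem (by exact ha)]
          refine le_trans ?_ le_self_add
          calc p a * (f a).toOuterMeasure S ≤ p a * 1 := by
                gcongr
                have := (f a).toOuterMeasure.mono (Set.subset_univ S)
                refine this.trans ?_
                exact (PMF.toOuterMeasure_apply (f a) Set.univ).trans_le (by simp)
            _ = p a := mul_one _
    _ = ∑' a, Gᶜ.indicator p a + e := by
        rw [ENNReal.tsum_add, ENNReal.tsum_mul_right, PMF.tsum_coe, one_mul]

/-- Chebyshev: for independent indicators the variance of the sum is at most its mean. -/
theorem pi_real_sum_indicator_lt_half_le {ι : Type*} [Fintype ι] {X : ι → Type*}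
    [∀ i, MeasurableSpace (X i)] (μ : ∀ i, Measure (X i)) [∀ i, IsProbabilityMeasure (μ i)]
    (S : ∀ i, Set (X i)) (hS : ∀ i, MeasurableSet (S i)) (T : Finset ι) (m : ℝ) (hm : 0 < m)
    (hle : m ≤ ∑ i ∈ T, (μ i).real (S i)) :
    (Measure.pi μ) {ω | ∑ i ∈ T, (S i).indicator (1 : X i → ℝ) (ω i) < m / 2}
      ≤ ENNReal.ofReal (4 / m) := by
  classical
  let Z : ι → (∀ i, X i) → ℝ := fun i ω => (S i).indicator (1 : X i → ℝ) (ω i)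
  have hm1 : ∀ i, Measurable ((S i).indicator (1 : X i → ℝ)) := fun i =>
    measurable_one.indicator (hS i)
  have hmeas : ∀ i, Measurable (Z i) := fun i => (hm1 i).comp (measurable_pi_apply i)
  have hb : ∀ i ω, ‖Z i ω‖ ≤ 1 := by
    intro i ω
    by_cases h : ω i ∈ S i <;> simp [Z, h]
  have hL : ∀ i, MemLp (Z i) 2 (Measure.pi μ) := fun i =>
    MemLp.of_bound (hmeas i).aestronglyMeasurable 1 (ae_of_all _ (hb i))
  have hint : ∀ i, ∫ ω, Z i ω ∂(Measure.pi μ) = (μ i).real (S i) := by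
    intro i
    have h := (measurePreserving_eval μ i)
    have h2 := h.map_eq
    have : ∫ ω, Z i ω ∂(Measure.pi μ) = ∫ x, (S i).indicator (1 : X i → ℝ) x ∂(μ i) := by
      conv_rhs => rw [← h2]
      rw [integral_map h.measurable.aemeasurable (hm1 i).aestronglyMeasurable]
    rw [this, integral_indicator_one (hS i)]
  have hsq : ∀ i, Z i ^ 2 = Z i := by
    intro i
    funext ω
    by_cases h : ω i ∈ S i <;> simp [Z, h]
  have hvar : ∀ i, Var[Z i; Measure.pi μ] ≤ (μ i).real (S i) := by
    intro i
    refine (variance_le_expectation_sq (hmeas i).aestronglyMeasurable).trans ?_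
    rw [hsq i, hint i]
  have hind : iIndepFun Z (Measure.pi μ) :=
    iIndepFun_pi (μ := μ) (X := fun i => (S i).indicator (1 : X i → ℝ))
      fun i => (hm1 i).aemeasurable
  have hvs : Var[∑ i ∈ T, Z i; Measure.pi μ] ≤ ∑ i ∈ T, (μ i).real (S i) := by
    rw [IndepFun.variance_sum (fun i _ => hL i) fun i _ j _ hij => hind.indepFun hij]
    exact Finset.sum_le_sum fun i _ => hvar i
  set E := ∑ i ∈ T, (μ i).real (S i) with hE
  have hEpos : 0 < E := hm.trans_le hle
  have hEint : ∫ ω, (∑ i ∈ T, Z i) ω ∂(Measure.pi μ) = E := by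
    simp only [Finset.sum_apply]
    rw [integral_finsetSum _ fun i _ => (hL i).integrable (by norm_num)]
    exact Finset.sum_congr rfl fun i _ => hint i
  have hch := meas_ge_le_variance_div_sq (memLp_finsetSum' T fun i _ => hL i)
    (half_pos hEpos)
  rw [hEint] at hch
  refine (measure_mono ?_).trans (hch.trans (ENNReal.ofReal_le_ofReal ?_))
  · intro ω hω
    simp only [Set.mem_ofPred_eq, Finset.sum_apply] at hω ⊢
    rw [abs_sub_comm]
    refine le_trans ?_ (le_abs_self _)
    change ∑ i ∈ T, Z i ω < m / 2 at hω
    linarith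
  · calc _ ≤ E / (E / 2) ^ 2 := by gcongr
      _ = 4 / E := by field_simp; norm_num
      _ ≤ 4 / m := by gcongr

/-! ### Uniform pairings: first and second moments by symmetry. -/

section Pairings

variable {α : Type} [Fintype α] [DecidableEq α]

theorem mem_pairings {σ : Equiv.Perm α} : σ ∈ pairings α ↔ ∀ s, σ s ≠ s ∧ σ (σ s) = s := by
  simp [pairings]

theorem conj_mem_pairings {σ : Equiv.Perm α} (h : σ ∈ pairings α) (g : Equiv.Perm α) :
    g * σ * g⁻¹ ∈ pairings α := by
  rw [mem_pairings] at h ⊢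
  intro s
  refine ⟨fun hs => (h (g⁻¹ s)).1 ?_, ?_⟩
  · rw [Equiv.Perm.eq_inv_iff_eq]; exact hs
  · have := (h (g⁻¹ s)).2
    have e : g⁻¹ (g (σ (g⁻¹ s))) = σ (g⁻¹ s) := g.symm_apply_apply _
    simp only [Equiv.Perm.mul_apply]
    rw [e, this]
    exact g.apply_symm_apply s

/-- Conjugation by `g` relabels the half-edges and permutes the pairings. With transpositions it
shows that all admissible partners are equally likely. -/
theorem card_pairings_filter_le_of_swap (P Q : Equiv.Perm α → Prop) [DecidablePred P]
    [DecidablePred Q] (g : Equiv.Perm α) (h : ∀ σ, P σ → Q (g * σ * g⁻¹)) :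
    ((pairings α).filter P).card ≤ ((pairings α).filter Q).card := by
  refine Finset.card_le_card_of_injOn (fun σ => g * σ * g⁻¹) ?_ ?_
  · intro σ hσ
    simp only [Finset.coe_filter, Set.mem_ofPred_eq] at hσ ⊢
    exact ⟨conj_mem_pairings hσ.1 g, h σ hσ.2⟩
  · intro σ _ σ' _ hh
    simpa using hh

theorem card_pairings_apply_eq_mul {s t : α} (hst : s ≠ t) :
    ((pairings α).filter fun σ => σ s = t).card * (Fintype.card α - 1) = (pairings α).card := by
  have hsym : ∀ t₁ t₂ : α, s ≠ t₁ → s ≠ t₂ →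
      ((pairings α).filter fun σ => σ s = t₁).card
        ≤ ((pairings α).filter fun σ => σ s = t₂).card := by
    intro t₁ t₂ h1 h2
    refine card_pairings_filter_le_of_swap _ _ (Equiv.swap t₁ t₂) fun σ h => ?_
    simp [Equiv.swap_apply_of_ne_of_ne h1 h2, h]
  rw [Finset.card_eq_sum_card_fiberwise (s := pairings α) (f := fun σ => σ s)
    (t := Finset.univ.erase s)]
  · rw [Finset.sum_congr rfl fun t' ht' => le_antisymm
      (hsym t' t (Finset.ne_of_mem_erase ht').symm hst)
      (hsym t t' hst (Finset.ne_of_mem_erase ht').symm)]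
    rw [Finset.sum_const, Finset.card_erase_of_mem (Finset.mem_univ _), Finset.card_univ,
      smul_eq_mul, mul_comm]
  · intro σ hσ
    simpa using (mem_pairings.mp hσ s).1

theorem card_pairings_apply_eq_and_mul {s t s' t' : α} (hst : s ≠ t) (hss : s ≠ s') (hts : t ≠ s')
    (hst' : s ≠ t') (htt : t ≠ t') (hst'' : s' ≠ t') :
    ((pairings α).filter fun σ => σ s = t ∧ σ s' = t').card * (Fintype.card α - 3)
      = ((pairings α).filter fun σ => σ s = t).card := by
  have hsym : ∀ t₁ t₂ : α, s ≠ t₁ → t ≠ t₁ → s' ≠ t₁ → s ≠ t₂ → t ≠ t₂ → s' ≠ t₂ →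
      ((pairings α).filter fun σ => σ s = t ∧ σ s' = t₁).card
        ≤ ((pairings α).filter fun σ => σ s = t ∧ σ s' = t₂).card := by
    intro t₁ t₂ h1 h2 h3 h4 h5 h6
    refine card_pairings_filter_le_of_swap _ _ (Equiv.swap t₁ t₂) fun σ h => ?_
    simp [Equiv.swap_apply_of_ne_of_ne h1 h4, Equiv.swap_apply_of_ne_of_ne h2 h5,
      Equiv.swap_apply_of_ne_of_ne h3 h6, h]
  rw [Finset.card_eq_sum_card_fiberwise (s := (pairings α).filter fun σ => σ s = t)
    (f := fun σ => σ s') (t := ((Finset.univ.erase s).erase t).erase s')]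
  · have h3 : (((Finset.univ.erase s).erase t).erase s').card = Fintype.card α - 3 := by
      rw [Finset.card_erase_of_mem, Finset.card_erase_of_mem, Finset.card_erase_of_mem,
        Finset.card_univ]
      · omega
      all_goals simp [hst.symm, hss.symm, hts.symm]
    rw [← h3, mul_comm, ← smul_eq_mul, ← Finset.sum_const]
    refine Finset.sum_congr rfl fun u hu => ?_
    simp only [Finset.mem_erase, Finset.mem_univ, and_true] at hu
    rw [Finset.filter_filter]
    exact le_antisymm (hsym t' u hst' htt hst'' hu.2.2.symm hu.2.1.symm hu.1.symm)
      (hsym u t' hu.2.2.symm hu.2.1.symm hu.1.symm hst' htt hst'')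
  · intro σ hσ
    simp only [Finset.coe_filter, Set.mem_ofPred_eq] at hσ
    have hp := mem_pairings.mp hσ.1
    simp only [Finset.coe_erase, Finset.coe_univ, Set.mem_sdiff, Set.mem_univ, true_and,
      Set.mem_singleton_iff]
    refine ⟨⟨?_, ?_⟩, (hp s').1⟩
    · intro h
      have := (hp s').2
      rw [h, hσ.2] at this
      exact hts this
    · intro h
      rw [← hσ.2] at h
      exact hss (σ.injective h).symm

end Pairings

section Pairings

variable {α : Type} [Fintype α] [DecidableEq α]

theorem card_pairings_mem_mul {s : α} {B : Finset α} (hs : s ∉ B) :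
    ((pairings α).filter fun σ => σ s ∈ B).card * (Fintype.card α - 1)
      = B.card * (pairings α).card := by
  rw [Finset.card_eq_sum_card_fiberwise (f := fun σ => σ s) (t := B)
    (fun σ hσ => by simpa using (Finset.mem_filter.mp hσ).2), Finset.sum_mul,
    ← smul_eq_mul B.card, ← Finset.sum_const]
  refine Finset.sum_congr rfl fun t ht => ?_
  rw [← card_pairings_apply_eq_mul (s := s) (t := t) (fun h => hs (h ▸ ht)), Finset.filter_filter]
  congr 2
  ext σ
  simp only [Finset.mem_filter, and_congr_right_iff, and_iff_right_iff_imp]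
  rintro _ rfl
  exact ht

theorem card_pairings_mem_and_mem_mul {s s' : α} {B : Finset α} (hs : s ∉ B) (hs' : s' ∉ B)
    (hss : s ≠ s') :
    ((pairings α).filter fun σ => σ s ∈ B ∧ σ s' ∈ B).card
        * ((Fintype.card α - 1) * (Fintype.card α - 3))
      = B.card * (B.card - 1) * (pairings α).card := by
  have key : ∀ t ∈ B, ((pairings α).filter fun σ => σ s = t ∧ σ s' ∈ B).card
      * (Fintype.card α - 3) = (B.card - 1) * ((pairings α).filter fun σ => σ s = t).card := by
    intro t ht
    rw [Finset.card_eq_sum_card_fiberwise (f := fun σ => σ s') (t := B.erase t), Finset.sum_mul,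
      ← Finset.card_erase_of_mem ht, ← smul_eq_mul (B.erase t).card, ← Finset.sum_const]
    · refine Finset.sum_congr rfl fun t' ht' => ?_
      rw [Finset.mem_erase] at ht'
      rw [← card_pairings_apply_eq_and_mul (s := s) (t := t) (s' := s') (t' := t')
        (fun h => hs (h ▸ ht)) hss (fun h => hs' (h ▸ ht)) (fun h => hs (h ▸ ht'.2))
        ht'.1.symm (fun h => hs' (h ▸ ht'.2)), Finset.filter_filter]
      congr 2
      ext σ
      simp only [Finset.mem_filter, and_congr_right_iff, and_assoc, and_iff_right_iff_imp]
      rintro _ _ rfl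
      exact ht'.2
    · intro σ hσ
      obtain ⟨-, h1, h2⟩ := Finset.mem_filter.mp hσ
      simp only [Finset.coe_erase, Set.mem_sdiff, Finset.mem_coe, Set.mem_singleton_iff]
      exact ⟨h2, fun h => hss (σ.injective (h1.trans h.symm))⟩
  rw [Finset.card_eq_sum_card_fiberwise (f := fun σ => σ s) (t := B)
    (fun σ hσ => by simpa using (Finset.mem_filter.mp hσ).2.1), Finset.sum_mul, mul_assoc,
    ← smul_eq_mul B.card, ← Finset.sum_const]
  refine Finset.sum_congr rfl fun t ht => ?_
  have : ((pairings α).filter fun σ => (σ s ∈ B ∧ σ s' ∈ B) ∧ σ s = t)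
      = (pairings α).filter fun σ => σ s = t ∧ σ s' ∈ B := by
    ext σ
    simp only [Finset.mem_filter]
    constructor
    · rintro ⟨h, ⟨h1, h2⟩, h3⟩
      exact ⟨h, h3, h2⟩
    · rintro ⟨h, rfl, h2⟩
      exact ⟨h, ⟨ht, h2⟩, rfl⟩
  rw [Finset.filter_filter, this,
    ← card_pairings_apply_eq_mul (s := s) (t := t) (fun h => hs (h ▸ ht)), ← mul_assoc,
    mul_right_comm, key t ht]
  ring

theorem sum_card_pairings_filter_mem {A B : Finset α} (hAB : Disjoint A B)
    (hL : 2 ≤ Fintype.card α) :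
    ∑ σ ∈ pairings α, ((A.filter fun s => σ s ∈ B).card : ℝ)
      = A.card * B.card * (pairings α).card / (Fintype.card α - 1) := by
  have hL' : (2 : ℝ) ≤ Fintype.card α := by exact_mod_cast hL
  have h1 : ∀ s ∈ A, (((pairings α).filter fun σ => σ s ∈ B).card : ℝ)
      = B.card * (pairings α).card / (Fintype.card α - 1) := by
    intro s hs
    rw [eq_div_iff (by linarith)]
    have := card_pairings_mem_mul (s := s) (B := B) (Finset.disjoint_left.mp hAB hs)
    rw [← Nat.cast_one, ← Nat.cast_sub (by omega)]
    exact_mod_cast this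
  simp only [Finset.card_filter, Nat.cast_sum] at h1 ⊢
  rw [Finset.sum_comm, Finset.sum_congr rfl h1, Finset.sum_const, nsmul_eq_mul]
  ring

theorem sum_sq_card_pairings_filter_mem {A B : Finset α} (hAB : Disjoint A B)
    (hL : 4 ≤ Fintype.card α) (hB : 1 ≤ B.card) :
    ∑ σ ∈ pairings α, ((A.filter fun s => σ s ∈ B).card : ℝ) ^ 2
      = A.card * B.card * (pairings α).card / (Fintype.card α - 1)
        + A.card * (A.card - 1) * (B.card * (B.card - 1) * (pairings α).card
          / ((Fintype.card α - 1) * (Fintype.card α - 3))) := by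
  have hL' : (4 : ℝ) ≤ Fintype.card α := by exact_mod_cast hL
  have h2 : ∀ s ∈ A, ∀ s' ∈ A.erase s,
      (((pairings α).filter fun σ => σ s ∈ B ∧ σ s' ∈ B).card : ℝ)
      = B.card * (B.card - 1) * (pairings α).card
        / ((Fintype.card α - 1) * (Fintype.card α - 3)) := by
    intro s hs s' hs'
    rw [eq_div_iff (by apply ne_of_gt; apply mul_pos <;> linarith)]
    have := card_pairings_mem_and_mem_mul (s := s) (s' := s') (B := B)
      (Finset.disjoint_left.mp hAB hs)
      (Finset.disjoint_left.mp hAB (Finset.mem_of_mem_erase hs'))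
      (Finset.ne_of_mem_erase hs').symm
    have c1 : ((Fintype.card α - 1 : ℕ) : ℝ) = Fintype.card α - 1 := by
      push_cast [show 1 ≤ Fintype.card α by omega]; ring
    have c3 : ((Fintype.card α - 3 : ℕ) : ℝ) = Fintype.card α - 3 := by
      push_cast [show 3 ≤ Fintype.card α by omega]; ring
    have c2 : ((B.card - 1 : ℕ) : ℝ) = B.card - 1 := by
      push_cast [hB]; ring
    rw [← c1, ← c3, ← c2]
    exact_mod_cast this
  have hsq : ∀ σ : Equiv.Perm α, ((A.filter fun s => σ s ∈ B).card : ℝ) ^ 2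
      = (A.filter fun s => σ s ∈ B).card
        + ∑ s ∈ A, ∑ s' ∈ A.erase s, if σ s ∈ B ∧ σ s' ∈ B then (1 : ℝ) else 0 := by
    intro σ
    simp only [Finset.card_filter, Nat.cast_sum, Nat.cast_ite, Nat.cast_one, Nat.cast_zero]
    rw [sq, Finset.sum_mul_sum, ← Finset.sum_add_distrib]
    refine Finset.sum_congr rfl fun s hs => ?_
    rw [← Finset.add_sum_erase A _ hs]
    congr 1
    · split_ifs <;> simp
    · refine Finset.sum_congr rfl fun s' _ => ?_
      by_cases h1 : σ s ∈ B <;> by_cases h2 : σ s' ∈ B <;> simp [h1, h2]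
  rw [Finset.sum_congr rfl fun σ _ => hsq σ, Finset.sum_add_distrib,
    sum_card_pairings_filter_mem hAB (by omega)]
  congr 1
  rw [Finset.sum_comm]
  simp only [Finset.sum_comm (s := pairings α)]
  have h3 : ∀ s ∈ A, ∑ s' ∈ A.erase s, ∑ σ ∈ pairings α,
      (if σ s ∈ B ∧ σ s' ∈ B then (1 : ℝ) else 0) = (A.card - 1) * (B.card * (B.card - 1)
        * (pairings α).card / ((Fintype.card α - 1) * (Fintype.card α - 3))) := by
    intro s hs
    have : ∀ s' ∈ A.erase s, ∑ σ ∈ pairings α, (if σ s ∈ B ∧ σ s' ∈ B then (1 : ℝ) else 0)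
        = B.card * (B.card - 1) * (pairings α).card
          / ((Fintype.card α - 1) * (Fintype.card α - 3)) := by
      intro s' hs'
      rw [← h2 s hs s' hs', Finset.card_filter]
      push_cast
      rfl
    rw [Finset.sum_congr rfl this, Finset.sum_const, nsmul_eq_mul, Finset.card_erase_of_mem hs,
      Nat.cast_sub (Finset.card_pos.mpr ⟨s, hs⟩), Nat.cast_one]
  rw [Finset.sum_congr rfl h3, Finset.sum_const, nsmul_eq_mul]
  ring

/-- Chebyshev again. The events `σ s ∈ B` for `s ∈ A` are nearly uncorrelated: their covariances
contribute only the term `12 / B.card`. -/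
theorem card_pairings_filter_lt_le {A B : Finset α} (hAB : Disjoint A B) (hA : A.Nonempty)
    (hB : B.Nonempty) :
    (((pairings α).filter fun σ => ((A.filter fun s => σ s ∈ B).card : ℝ)
        < A.card * B.card / (2 * Fintype.card α)).card : ℝ)
      ≤ (4 * Fintype.card α / (A.card * B.card) + 12 / B.card) * (pairings α).card := by
  have ha : (1 : ℝ) ≤ A.card := by exact_mod_cast hA.card_pos
  have hr : (1 : ℝ) ≤ B.card := by exact_mod_cast hB.card_pos
  have hLnat : A.card + B.card ≤ Fintype.card α := by
    rw [← Finset.card_union_of_disjoint hAB]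
    exact Finset.card_le_univ _
  have hsum : (A.card : ℝ) + B.card ≤ Fintype.card α := by exact_mod_cast hLnat
  have hN : (0 : ℝ) ≤ (pairings α).card := by positivity
  -- For `B.card ≤ 12` the bound is at least the number of all pairings; otherwise there are enough
  -- half-edges to divide by `l - 3`.
  by_cases h12 : (B.card : ℝ) ≤ 12
  · have h1 : (1 : ℝ) ≤ 4 * Fintype.card α / (A.card * B.card) + 12 / B.card := by
      have h2 : (1 : ℝ) ≤ 12 / B.card := by rw [le_div_iff₀ (by linarith)]; linarith
      have : (0 : ℝ) ≤ 4 * Fintype.card α / (A.card * B.card) := by positivity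
      linarith
    calc _ ≤ ((pairings α).card : ℝ) := by exact_mod_cast Finset.card_filter_le _ _
      _ ≤ _ := le_mul_of_one_le_left hN h1
  push Not at h12
  have hL4 : 4 ≤ Fintype.card α := by
    have : (12 : ℝ) < Fintype.card α := by linarith
    have : 12 < Fintype.card α := by exact_mod_cast this
    omega
  have hS1 := sum_card_pairings_filter_mem hAB (by omega : 2 ≤ Fintype.card α)
  have hS2 := sum_sq_card_pairings_filter_mem hAB hL4 hB.card_pos
  generalize hX : (fun σ : Equiv.Perm α => ((A.filter fun s => σ s ∈ B).card : ℝ)) = X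
  have hX' : ∀ σ, ((A.filter fun s => σ s ∈ B).card : ℝ) = X σ := fun σ => by rw [← hX]
  simp only [hX'] at hS1 hS2 ⊢
  generalize (A.card : ℝ) = a at *
  generalize (B.card : ℝ) = r at *
  generalize (Fintype.card α : ℝ) = l at *
  set P := pairings α
  set q := r / (l - 1) with hq
  have hl1 : 0 < l - 1 := by linarith
  have hl3 : 0 < l - 3 := by linarith
  have hqpos : 0 < q := by positivity
  have hcheb : ((P.filter fun σ => X σ < a * r / (2 * l)).card : ℝ) * (a * q / 2) ^ 2
      ≤ ∑ σ ∈ P, (X σ - a * q) ^ 2 := by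
    rw [← nsmul_eq_mul, ← Finset.sum_const]
    refine le_trans (Finset.sum_le_sum (g := fun σ => (X σ - a * q) ^ 2) fun σ hσ => ?_)
      (Finset.sum_le_sum_of_subset_of_nonneg (Finset.filter_subset _ _)
        fun _ _ _ => sq_nonneg _)
    have h1 := (Finset.mem_filter.mp hσ).2
    have h2 : a * r / (2 * l) ≤ a * q / 2 := by
      rw [hq, ← mul_div_assoc, div_div, mul_comm (l - 1)]
      gcongr
      linarith
    have h3 : a * q / 2 ≤ a * q - X σ := by linarith
    have h4 : 0 ≤ a * q / 2 := by positivity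
    nlinarith
  have hV : ∑ σ ∈ P, (X σ - a * q) ^ 2 ≤ (a * q + a ^ 2 * q / (l - 3)) * P.card := by
    have : ∀ σ ∈ P, (X σ - a * q) ^ 2 = X σ ^ 2 - 2 * (a * q) * X σ + (a * q) ^ 2 :=
      fun σ _ => by ring
    rw [Finset.sum_congr rfl this, Finset.sum_add_distrib, Finset.sum_sub_distrib,
      ← Finset.mul_sum, hS1, hS2, Finset.sum_const, nsmul_eq_mul]
    have e : a * r * P.card / (l - 1) + a * (a - 1) * (r * (r - 1) * P.card
          / ((l - 1) * (l - 3))) - 2 * (a * q) * (a * r * P.card / (l - 1))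
          + P.card * (a * q) ^ 2
        = (a * q + a * q * ((a - 1) * ((r - 1) / (l - 3)) - a * q)) * P.card := by
      rw [hq]; field_simp; ring
    rw [e]
    -- Pairing one half-edge into `B` raises the probability for another one by at most `1 / (l -
    -- 3)`; this uses `r ≤ l - 1`.
    have h5 : (r - 1) / (l - 3) - q ≤ 1 / (l - 3) := by
      rw [hq, div_sub_div _ _ hl3.ne' hl1.ne', div_le_div_iff₀ (by positivity) hl3]
      nlinarith
    have h6 : (a - 1) * ((r - 1) / (l - 3)) ≤ a * ((r - 1) / (l - 3)) := by
      refine mul_le_mul_of_nonneg_right (by linarith) (div_nonneg ?_ ?_) <;> linarith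
    have h7 : (a - 1) * ((r - 1) / (l - 3)) - a * q ≤ a * (1 / (l - 3)) := by
      nlinarith
    calc _ ≤ (a * q + a * q * (a * (1 / (l - 3)))) * P.card := by gcongr
      _ = _ := by ring
  have hfin := hcheb.trans hV
  rw [← le_div_iff₀ (by positivity)] at hfin
  refine hfin.trans ?_
  have e2 : (a * q + a ^ 2 * q / (l - 3)) * P.card / (a * q / 2) ^ 2
      = (4 * (l - 1) / (a * r) + 4 * (l - 1) / (r * (l - 3))) * P.card := by
    rw [hq]; field_simp; ring
  rw [e2]
  gcongr ?_ * _
  refine add_le_add ?_ ?_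
  · gcongr; linarith
  · rw [div_le_div_iff₀ (by positivity) (by positivity)]
    nlinarith

end Pairings

/-! ### The percolated degrees at one scale. -/

theorem toPMF_toOuterMeasure {α : Type*} [MeasurableSpace α] [Countable α]
    [MeasurableSingletonClass α] (μ : Measure α) [IsProbabilityMeasure μ] (S : Set α) :
    μ.toPMF.toOuterMeasure S = μ S := by
  rw [← PMF.toMeasure_apply_eq_toOuterMeasure_apply _ (S.to_countable.measurableSet),
    Measure.toPMF_toMeasure]

theorem le_evenDegrees {n : ℕ} (d : Fin n → ℕ) (i : Fin n) : d i ≤ evenDegrees d i := by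
  unfold evenDegrees; split_ifs <;> omega

theorem evenDegrees_le {n : ℕ} (d : Fin n → ℕ) (i : Fin n) : evenDegrees d i ≤ d i + 1 := by
  unfold evenDegrees; split_ifs <;> omega

theorem iidDegrees_card_lt_half_le (ν : Measure ℕ) [IsProbabilityMeasure ν] {n : ℕ} (hn : 0 < n)
    (S : Set ℕ) [DecidablePred (· ∈ S)] (hS : 0 < ν.real S) :
    (iidDegrees ν n).toOuterMeasure
        {d | ((Finset.univ.filter fun i => d i ∈ S).card : ℝ) < n * ν.real S / 2}
      ≤ ENNReal.ofReal (4 / (n * ν.real S)) := by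
  rw [iidDegrees, toPMF_toOuterMeasure]
  refine le_trans (measure_mono fun d hd => ?_) (pi_real_sum_indicator_lt_half_le
    (fun _ : Fin n => ν) (fun _ => S) (fun _ => S.to_countable.measurableSet) Finset.univ
    (n * ν.real S) (by positivity) (by simp))
  rw [Set.mem_ofPred_eq] at hd ⊢
  convert hd using 1
  rw [Finset.card_filter, Nat.cast_sum]
  refine Finset.sum_congr rfl fun i _ => ?_
  by_cases h : d i ∈ S <;> simp [h]

theorem retention_card_lt_half_le {n : ℕ} (d : Fin n → ℕ) {p : ℕ → unitInterval}
    (hp : Antitone p) (T : Finset (HalfEdge d)) (N : ℕ) (hT : ∀ s ∈ T, d s.1 ≤ N) {m : ℝ}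
    (hm : 0 < m) (hmT : m ≤ T.card * (p N : ℝ)) :
    (retention d p).toOuterMeasure
        {keep | ((T.filter fun s => keep s = true).card : ℝ) < m / 2}
      ≤ ENNReal.ofReal (4 / m) := by
  rw [retention, toPMF_toOuterMeasure]
  refine le_trans (measure_mono fun keep hk => ?_) (pi_real_sum_indicator_lt_half_le
    (fun s : HalfEdge d => bernoulliMeasure true false (p (d s.1))) (fun _ => {true})
    (fun _ => measurableSet_singleton _) T m hm ?_)
  · rw [Set.mem_ofPred_eq] at hk ⊢
    convert hk using 1
    rw [Finset.card_filter, Nat.cast_sum]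
    refine Finset.sum_congr rfl fun s _ => ?_
    by_cases h : keep s = true <;> simp [h]
  · refine hmT.trans ?_
    rw [← nsmul_eq_mul, ← Finset.sum_const]
    refine Finset.sum_le_sum fun s hs => ?_
    rw [bernoulliMeasure_real_apply_of_mem_of_notMem _ (measurableSet_singleton _)
      (by simp) (by simp)]
    exact hp (hT s hs)

theorem card_filter_le_sum_rrDegree {n : ℕ} (d : Fin n → ℕ) (keep : HalfEdge d → Bool)
    (σ : Equiv.Perm (HalfEdge d)) (W : Finset (Fin n)) (A B : Finset (HalfEdge d))
    (hA : ∀ s ∈ A, s.1 ∈ W ∧ keep s = true) (hB : ∀ s ∈ B, keep s = true) :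
    (A.filter fun s => σ s ∈ B).card ≤ ∑ i ∈ W, rrDegree d keep σ i := by
  unfold rrDegree
  rw [← Finset.card_sigma]
  refine Finset.card_le_card fun s hs => ?_
  rw [Finset.mem_filter] at hs
  rw [Finset.mem_sigma]
  refine ⟨(hA s hs.1).1, ?_⟩
  simp only [Finset.mem_filter, Finset.mem_univ, true_and, Sigma.eta]
  exact ⟨(hA s hs.1).2, hB _ hs.2⟩

theorem rrDegree_le {n : ℕ} (d : Fin n → ℕ) (keep : HalfEdge d → Bool)
    (σ : Equiv.Perm (HalfEdge d)) (i : Fin n) : rrDegree d keep σ i ≤ d i :=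
  (Finset.card_le_univ _).trans_eq (Fintype.card_fin _)

/-- The averaging step: a lower bound on the total final degree of `W` becomes a lower bound on the
number of vertices above `x`. -/
theorem sum_rrDegree_le {n : ℕ} (d : Fin n → ℕ) (keep : HalfEdge d → Bool)
    (σ : Equiv.Perm (HalfEdge d)) (W : Finset (Fin n)) (M : ℕ) (hW : ∀ i ∈ W, d i ≤ M) {x : ℝ}
    (hx : 0 ≤ x) :
    ((∑ i ∈ W, rrDegree d keep σ i : ℕ) : ℝ) ≤ x * W.card
      + M * ((Finset.univ.filter fun i => x < rrDegree d keep σ i).card : ℝ) := by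
  have h1 : ∀ i ∈ W, (rrDegree d keep σ i : ℝ)
      ≤ x + M * (if x < rrDegree d keep σ i then (1 : ℝ) else 0) := by
    intro i hi
    have : (rrDegree d keep σ i : ℝ) ≤ M := by
      exact_mod_cast (rrDegree_le d keep σ i).trans (hW i hi)
    split_ifs with h <;> linarith
  push_cast
  refine (Finset.sum_le_sum h1).trans ?_
  rw [Finset.sum_add_distrib, Finset.sum_const, nsmul_eq_mul, ← Finset.mul_sum, mul_comm x,
    Finset.card_filter]
  push_cast
  gcongr
  exact Finset.subset_univ W

theorem uniformOfFinset_pairings_le {n : ℕ} (d : Fin n → ℕ) (keep : HalfEdge d → Bool)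
    (hne : (pairings (HalfEdge d)).Nonempty) (W : Finset (Fin n)) {A B : Finset (HalfEdge d)}
    (hA : ∀ s ∈ A, s.1 ∈ W ∧ keep s = true) (hB : ∀ s ∈ B, keep s = true) (hAB : Disjoint A B)
    {M : ℕ} (hW : ∀ i ∈ W, d i ≤ M) {x a r l : ℝ} (hx : 0 ≤ x) (ha : 0 < a) (hr : 0 < r)
    (haA : a ≤ A.card) (hrB : r ≤ B.card) (hl : (totalDegree d : ℝ) ≤ l)
    (hM : 2 * x * W.card ≤ a * r / (2 * l)) :
    (PMF.uniformOfFinset (pairings (HalfEdge d)) hne).toOuterMeasure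
        {σ | M * ((Finset.univ.filter fun i => x < rrDegree d keep σ i).card : ℝ) < x * W.card}
      ≤ ENNReal.ofReal (4 * l / (a * r) + 12 / r) := by
  classical
  have hA0 : (0 : ℝ) < A.card := ha.trans_le haA
  have hB0 : (0 : ℝ) < B.card := hr.trans_le hrB
  have hA1 : A.Nonempty := by rw [← Finset.card_pos]; exact_mod_cast hA0
  have hB1 : B.Nonempty := by rw [← Finset.card_pos]; exact_mod_cast hB0
  have hL0 : (0 : ℝ) < totalDegree d := by
    have := Finset.card_le_univ A
    rw [card_halfEdge] at this
    exact hA0.trans_le (by exact_mod_cast this)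
  have hl0 : 0 < l := hL0.trans_le hl
  rw [PMF.toOuterMeasure_uniformOfFinset_apply]
  have hP : 0 < (pairings (HalfEdge d)).card := hne.card_pos
  rw [← ENNReal.ofReal_natCast, ← ENNReal.ofReal_natCast (pairings (HalfEdge d)).card,
    ← ENNReal.ofReal_div_of_pos (by exact_mod_cast hP)]
  refine ENNReal.ofReal_le_ofReal ?_
  rw [div_le_iff₀ (by exact_mod_cast hP)]
  have key := card_pairings_filter_lt_le hAB hA1 hB1
  rw [card_halfEdge] at key
  refine le_trans ?_ (key.trans ?_)
  · rw [Nat.cast_le]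
    refine Finset.card_le_card fun σ hσ => ?_
    rw [Finset.mem_filter] at hσ ⊢
    refine ⟨hσ.1, ?_⟩
    have hs := hσ.2
    rw [Set.mem_ofPred_eq] at hs
    have h1 : ((A.filter fun s => σ s ∈ B).card : ℝ)
        ≤ ((∑ i ∈ W, rrDegree d keep σ i : ℕ) : ℝ) := by
      exact_mod_cast card_filter_le_sum_rrDegree d keep σ W A B hA hB
    have h2 := sum_rrDegree_le d keep σ W M hW hx
    have h3 : a * r / (2 * l) ≤ A.card * B.card / (2 * totalDegree d) := by gcongr
    linarith
  · gcongr

/-- Degrees, retention and pairing are controlled in turn, each conditionally on the preceding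
stages. The values `m + 1` and `M + 1` leave room for the half-edge added by the parity correction.
-/
theorem percolatedLaw_card_lt_le (ν : Measure ℕ) [IsProbabilityMeasure ν] {p : ℕ → unitInterval}
    (hp : Antitone p) {n m Y M : ℕ} (hn : 0 < n) (hmY : m + 1 ≤ Y) {β x ρ π q φ : ℝ} (hβ : 0 < β)
    (hρ : ν.real (Set.Icc 1 m) = ρ) (hρ0 : 0 < ρ) (hπ : (p (m + 1) : ℝ) = π) (hπ0 : 0 < π)
    (hq : ν.real (Set.Ioc Y M) = q) (hq0 : 0 < q) (hφ : (p (M + 1) : ℝ) = φ) (hφ0 : 0 < φ)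
    (hx : 0 ≤ x) (hxY : x ≤ Y * φ * ρ * π / (32 * β)) :
    (percolatedLaw ν p n).toOuterMeasure
        {ω | (totalDegree ω.1 : ℝ) ≤ n * β ∧
          ((Finset.univ.filter fun i => x < ω.2 i).card : ℝ) < x * n * q / (2 * (M + 1))}
      ≤ ENNReal.ofReal ((72 + 64 * β) / (n * q * φ * ρ * π)) := by
  classical
  have hn' : (0 : ℝ) < n := by exact_mod_cast hn
  have hρ1 : ρ ≤ 1 := hρ ▸ measureReal_le_one
  have hq1 : q ≤ 1 := hq ▸ measureReal_le_one
  have hπ1 : π ≤ 1 := hπ ▸ (p (m + 1)).2.2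
  have hφ1 : φ ≤ 1 := hφ ▸ (p (M + 1)).2.2
  set S := {ω : (Fin n → ℕ) × (Fin n → ℕ) | (totalDegree ω.1 : ℝ) ≤ n * β ∧
          ((Finset.univ.filter fun i => x < ω.2 i).card : ℝ) < x * n * q / (2 * (M + 1))}
  let G1 : Set (Fin n → ℕ) := {d | n * q / 2 ≤ ((Finset.univ.filter fun i =>
    d i ∈ Set.Ioc Y M).card : ℝ)} ∩ {d | n * ρ / 2 ≤ ((Finset.univ.filter fun i =>
    d i ∈ Set.Icc 1 m).card : ℝ)}
  have hG1 : (iidDegrees ν n).toOuterMeasure G1ᶜ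
      ≤ ENNReal.ofReal (4 / (n * q)) + ENNReal.ofReal (4 / (n * ρ)) := by
    have h1 := iidDegrees_card_lt_half_le ν hn (Set.Ioc Y M) (hq ▸ hq0)
    have h2 := iidDegrees_card_lt_half_le ν hn (Set.Icc 1 m) (hρ ▸ hρ0)
    rw [hq] at h1
    rw [hρ] at h2
    rw [Set.compl_inter]
    refine (measure_union_le _ _).trans (add_le_add ?_ ?_)
    · refine le_trans (measure_mono fun d hd => ?_) h1
      simpa using hd
    · refine le_trans (measure_mono fun d hd => ?_) h2
      simpa using hd
  have hstep : ∀ d₀ ∈ G1, ((retention (evenDegrees d₀) p).bind fun keep =>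
      (PMF.uniformOfFinset (pairings (HalfEdge (evenDegrees d₀)))
        (pairings_evenDegrees_nonempty d₀)).map fun σ =>
          (evenDegrees d₀, rrDegree (evenDegrees d₀) keep σ)).toOuterMeasure S
      ≤ ENNReal.ofReal (8 / (n * q * φ)) + ENNReal.ofReal (8 / (n * ρ * π))
        + ENNReal.ofReal (64 * β / (n * q * φ * ρ * π) + 48 / (n * ρ * π)) := by
    intro d₀ hd₀
    set d := evenDegrees d₀ with hd
    -- The event `S` includes the bound on the total degree, so it is impossible here.
    by_cases hL : ¬ (totalDegree d : ℝ) ≤ n * β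
    · refine le_trans (toOuterMeasure_bind_le _ _ Set.univ S 0 fun keep _ => ?_) ?_
      · rw [PMF.toOuterMeasure_map_apply]
        rw [nonpos_iff_eq_zero]
        refine measure_mono_null (t := ∅) (fun σ hσ => hL hσ.1) measure_empty
      · simp
    push Not at hL
    set W := Finset.univ.filter fun i => Y < d i ∧ d i ≤ M + 1 with hW
    set V := Finset.univ.filter fun i => 1 ≤ d i ∧ d i ≤ m + 1 with hV
    have hWc : n * q / 2 ≤ W.card := by
      refine hd₀.1.trans ?_
      norm_cast
      refine Finset.card_le_card fun i hi => ?_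
      simp only [Finset.mem_filter, Finset.mem_univ, true_and, Set.mem_Ioc, hW] at hi ⊢
      have h1 := le_evenDegrees d₀ i
      have h2 := evenDegrees_le d₀ i
      rw [← hd] at h1 h2
      omega
    have hVc : n * ρ / 2 ≤ V.card := by
      refine hd₀.2.trans ?_
      norm_cast
      refine Finset.card_le_card fun i hi => ?_
      simp only [Finset.mem_filter, Finset.mem_univ, true_and, Set.mem_Icc, hV] at hi ⊢
      have h1 := le_evenDegrees d₀ i
      have h2 := evenDegrees_le d₀ i
      rw [← hd] at h1 h2
      omega
    set TW : Finset (HalfEdge d) := W.sigma fun _ => Finset.univ with hTW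
    set TV : Finset (HalfEdge d) := V.sigma fun _ => Finset.univ with hTV
    have hTWc : (W.card : ℝ) * Y ≤ TW.card := by
      rw [hTW, Finset.card_sigma]
      norm_cast
      rw [← smul_eq_mul, ← Finset.sum_const]
      refine Finset.sum_le_sum fun i hi => ?_
      rw [Finset.card_univ, Fintype.card_fin]
      exact (Finset.mem_filter.mp hi).2.1.le
    have hTVc : (V.card : ℝ) ≤ TV.card := by
      rw [hTV, Finset.card_sigma]
      norm_cast
      rw [Finset.card_eq_sum_ones]
      refine Finset.sum_le_sum fun i hi => ?_
      rw [Finset.card_univ, Fintype.card_fin]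
      exact (Finset.mem_filter.mp hi).2.1
    have hY1 : (1 : ℝ) ≤ Y := by
      have : 1 ≤ Y := by omega
      exact_mod_cast this
    have hW0 : (0 : ℝ) < W.card := lt_of_lt_of_le (by positivity) hWc
    have hV0 : (0 : ℝ) < V.card := lt_of_lt_of_le (by positivity) hVc
    let G2 : Set (HalfEdge d → Bool) :=
      {keep | W.card * Y * φ / 2 ≤ ((TW.filter fun s => keep s = true).card : ℝ)}
      ∩ {keep | n * ρ / 2 * π / 2 ≤ ((TV.filter fun s => keep s = true).card : ℝ)}
    have hG2 : (retention d p).toOuterMeasure G2ᶜ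
        ≤ ENNReal.ofReal (8 / (n * q * φ)) + ENNReal.ofReal (8 / (n * ρ * π)) := by
      have h1 := retention_card_lt_half_le d hp TW (M + 1)
        (fun s hs => (Finset.mem_filter.mp (Finset.mem_sigma.mp hs).1).2.2)
        (m := W.card * Y * φ) (by positivity) (by rw [hφ]; gcongr)
      have h2 := retention_card_lt_half_le d hp TV (m + 1)
        (fun s hs => (Finset.mem_filter.mp (Finset.mem_sigma.mp hs).1).2.2)
        (m := n * ρ / 2 * π) (by positivity) (by rw [hπ]; gcongr; linarith)
      rw [Set.compl_inter]
      refine (measure_union_le _ _).trans (add_le_add ?_ ?_)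
      · refine le_trans (measure_mono fun keep hk => ?_)
          (h1.trans (ENNReal.ofReal_le_ofReal ?_))
        · simpa using hk
        · rw [div_le_div_iff₀ (by positivity) (by positivity)]
          have : n * q / 2 * 1 * φ ≤ W.card * Y * φ := by gcongr
          linarith
      · refine le_trans (measure_mono fun keep hk => ?_)
          (h2.trans (ENNReal.ofReal_le_ofReal (le_of_eq ?_)))
        · simpa using hk
        · field_simp; norm_num
    refine (toOuterMeasure_bind_le _ _ G2 S _ fun keep hk => ?_).trans (add_le_add hG2 le_rfl)
    rw [PMF.toOuterMeasure_map_apply]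
    have key := uniformOfFinset_pairings_le d keep (pairings_evenDegrees_nonempty d₀) W
      (A := TW.filter fun s => keep s = true) (B := TV.filter fun s => keep s = true)
      (M := M + 1) (x := x) (a := W.card * Y * φ / 2) (r := n * ρ / 2 * π / 2) (l := n * β)
      (fun s hs => ⟨(Finset.mem_sigma.mp (Finset.mem_filter.mp hs).1).1,
        (Finset.mem_filter.mp hs).2⟩)
      (fun s hs => (Finset.mem_filter.mp hs).2)
      -- `A` and `B` are disjoint because degrees in `W` exceed `Y ≥ m + 1` and degrees in `V` do
      -- not exceed `m + 1`.
      (by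
        rw [Finset.disjoint_left]
        intro s hs hs'
        have h1 := Finset.mem_filter.mp (Finset.mem_sigma.mp (Finset.mem_filter.mp hs).1).1
        have h2 := Finset.mem_filter.mp (Finset.mem_sigma.mp (Finset.mem_filter.mp hs').1).1
        omega)
      (fun i hi => (Finset.mem_filter.mp hi).2.2) hx (by positivity) (by positivity)
      hk.1 hk.2 hL
      (by
        have h1 : W.card * Y * φ / 2 * (n * ρ / 2 * π / 2) / (2 * (n * β))
            = 2 * (Y * φ * ρ * π / (32 * β)) * W.card := by
          field_simp; norm_num
        rw [h1]
        gcongr)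
    refine (measure_mono fun σ hσ => ?_).trans (key.trans (ENNReal.ofReal_le_ofReal ?_))
    · have h1 := hσ.2
      simp only at h1
      rw [Set.mem_ofPred_eq]
      rw [lt_div_iff₀ (by positivity)] at h1
      have h2 : x * (n * q / 2) ≤ x * W.card := by gcongr
      push_cast
      linarith
    · refine add_le_add ?_ (le_of_eq (by field_simp; norm_num))
      have h1 : n * q / 2 * 1 * φ ≤ W.card * Y * φ := by gcongr
      calc 4 * (n * β) / (W.card * Y * φ / 2 * (n * ρ / 2 * π / 2))
          ≤ 4 * (n * β) / (n * q / 2 * 1 * φ / 2 * (n * ρ / 2 * π / 2)) := by gcongr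
        _ = _ := by field_simp; norm_num
  refine (toOuterMeasure_bind_le _ _ G1 S _ hstep).trans ((add_le_add hG1 le_rfl).trans ?_)
  rw [← ENNReal.ofReal_add (by positivity) (by positivity),
    ← ENNReal.ofReal_add (by positivity) (by positivity),
    ← ENNReal.ofReal_add (by positivity) (by positivity),
    ← ENNReal.ofReal_add (by positivity) (by positivity)]
  refine ENNReal.ofReal_le_ofReal ?_
  have e : ∀ t : ℝ, 0 ≤ t → ∀ D : ℝ, n * q * φ * ρ * π ≤ D → t / D ≤ t / (n * q * φ * ρ * π) :=
    fun t ht D hD => by gcongr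
  -- All factors `q`, `φ`, `ρ`, `π` are at most 1, so every error fits over the smallest
  -- denominator; `72 = 4 + 4 + 8 + 8 + 48`.
  have hle : ∀ u v : ℝ, 0 ≤ u → 0 ≤ v → v ≤ 1 → u * v ≤ u := fun u v hu _ hv =>
    mul_le_of_le_one_right hu hv
  have e1 := e 4 (by norm_num) (n * q) ((hle _ π (by positivity) hπ0.le hπ1).trans
    ((hle _ ρ (by positivity) hρ0.le hρ1).trans (hle _ φ (by positivity) hφ0.le hφ1)))
  have e2 := e 8 (by norm_num) (n * q * φ) ((hle _ π (by positivity) hπ0.le hπ1).trans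
    (hle _ ρ (by positivity) hρ0.le hρ1))
  have h3 : n * q * φ * ρ * π ≤ n * ρ * π := by
    have h := hle (n * ρ * π) (q * φ) (by positivity) (by positivity)
      (mul_le_one₀ hq1 hφ0.le hφ1)
    linarith
  have e3 := e 8 (by norm_num) _ h3
  have e4 := e 48 (by norm_num) _ h3
  have e5 := e 4 (by norm_num) (n * ρ) (h3.trans (hle _ π (by positivity) hπ0.le hπ1))
  calc _ ≤ 4 / (n * q * φ * ρ * π) + 4 / (n * q * φ * ρ * π)
        + (8 / (n * q * φ * ρ * π) + 8 / (n * q * φ * ρ * π)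
        + (64 * β / (n * q * φ * ρ * π) + 48 / (n * q * φ * ρ * π))) := by linarith
    _ = _ := by ring

/-! ### Finite mean and linear total degree. -/

theorem one_sub_degreeCDF (ν : Measure ℕ) [IsProbabilityMeasure ν] (x : ℝ) :
    1 - degreeCDF ν x = ν.real {k : ℕ | x < k} := by
  rw [degreeCDF, ← probReal_compl_eq_one_sub (Set.to_countable _).measurableSet]
  congr 1
  ext k
  simp

theorem tendsto_log_rpow_zero {γ : ℝ} (hγ : γ < 1) (C : ℝ) :
    Tendsto (fun x : ℝ => C * Real.log x ^ (γ - 1)) atTop (𝓝 0) := by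
  have := ((tendsto_rpow_neg_atTop (y := 1 - γ) (by linarith)).comp
    Real.tendsto_log_atTop).const_mul C
  simpa [Function.comp_def] using this

theorem PowerLaw.integrable {ν : Measure ℕ} [IsProbabilityMeasure ν] {τ γ C : ℝ} (hτ : 2 < τ)
    (hγ : γ < 1) (hF : PowerLaw (degreeCDF ν) τ γ C) : Integrable (fun k : ℕ => (k : ℝ)) ν := by
  have hsum : Summable fun j : ℕ => ν.real {k : ℕ | (j : ℝ) < k} := by
    -- The correction of the exponent tends to 0, so the tail is eventually below `j ^ (-(τ / 2))`,
    -- and `τ / 2 > 1`.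
    have h1 : Summable fun j : ℕ => (j : ℝ) ^ (-(τ / 2)) :=
      Real.summable_nat_rpow.mpr (by linarith)
    refine summable_of_isBigO_nat h1 (Asymptotics.IsBigO.of_bound 1 ?_)
    have hev : ∀ᶠ x : ℝ in atTop, C * Real.log x ^ (γ - 1) < τ / 2 - 1 :=
      (tendsto_log_rpow_zero hγ C).eventually_lt_const (by linarith)
    filter_upwards [tendsto_natCast_atTop_atTop.eventually hev,
      tendsto_natCast_atTop_atTop.eventually hF, eventually_ge_atTop 1] with j h1 h2 h3
    have h3' : (1 : ℝ) ≤ j := by exact_mod_cast h3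
    rw [one_sub_degreeCDF] at h2
    rw [one_mul, Real.norm_of_nonneg measureReal_nonneg, Real.norm_of_nonneg (by positivity)]
    exact h2.2.trans (Real.rpow_le_rpow_of_exponent_le h3' (by linarith))
  refine ⟨by fun_prop, ?_⟩
  rw [hasFiniteIntegral_iff_norm]
  have hk : ∀ k : ℕ, ENNReal.ofReal ‖(k : ℝ)‖
      = ∑' j : ℕ, ({k : ℕ | (j : ℝ) < k} : Set ℕ).indicator (1 : ℕ → ℝ≥0∞) k := by
    intro k
    rw [tsum_eq_sum (s := Finset.range k)]
    · rw [Finset.sum_congr rfl (g := fun _ => (1 : ℝ≥0∞)) fun j hj => ?_]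
      · simp
      · exact Set.indicator_of_mem (by simpa using hj) _
    · intro j hj
      simpa using hj
  simp_rw [hk]
  rw [lintegral_tsum fun j => (measurable_of_countable _).aemeasurable]
  have : ∀ j : ℕ, ∫⁻ k, ({k : ℕ | (j : ℝ) < k} : Set ℕ).indicator (1 : ℕ → ℝ≥0∞) k ∂ν
      = ENNReal.ofReal (ν.real {k : ℕ | (j : ℝ) < k}) := by
    intro j
    rw [lintegral_indicator_one (Set.to_countable _).measurableSet, ofReal_measureReal]
  simp_rw [this]
  exact hsum.tsum_ofReal_lt_top

/-- The strong law on the infinite product gives convergence in measure, and the first `n`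
coordinates have the law of the `n` degrees. -/
theorem tendsto_pi_sum_gt {ν : Measure ℕ} [IsProbabilityMeasure ν]
    (hν : Integrable (fun k : ℕ => (k : ℝ)) ν) {β : ℝ} (hβ : ∫ k : ℕ, (k : ℝ) ∂ν + 1 ≤ β) :
    Tendsto (fun n : ℕ => (Measure.pi fun _ : Fin n => ν) {d | n * β < totalDegree d})
      atTop (𝓝 0) := by
  let P : Measure (ℕ → ℕ) := Measure.infinitePi fun _ => ν
  let X : ℕ → (ℕ → ℕ) → ℝ := fun i ω => (ω i : ℝ)
  have hcast : Measurable fun k : ℕ => (k : ℝ) := measurable_of_countable _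
  have hmX : ∀ i, Measurable (X i) := fun i => hcast.comp (measurable_pi_apply i)
  have hmp : ∀ i : ℕ, MeasurePreserving (fun ω : ℕ → ℕ => ω i) P ν := fun i =>
    measurePreserving_eval_infinitePi (fun _ : ℕ => ν) i
  have hint : Integrable (X 0) P := (hmp 0).integrable_comp_of_integrable hν
  have hE : ∫ ω, X 0 ω ∂P = ∫ k : ℕ, (k : ℝ) ∂ν := by
    have h := (hmp 0).map_eq
    conv_rhs => rw [← h]
    rw [integral_map (hmp 0).measurable.aemeasurable hcast.aestronglyMeasurable]
  have hind : iIndepFun X P :=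
    iIndepFun_infinitePi (P := fun _ : ℕ => ν) (X := fun _ k => (k : ℝ)) fun _ => hcast
  have hident : ∀ i, IdentDistrib (X i) (X 0) P P := by
    intro i
    refine ⟨(hmX i).aemeasurable, (hmX 0).aemeasurable, ?_⟩
    have : ∀ j, P.map (X j) = ν.map fun k : ℕ => (k : ℝ) := by
      intro j
      rw [← (hmp j).map_eq, Measure.map_map hcast (hmp j).measurable]
      rfl
    rw [this, this]
  have hslln := strong_law_ae_real X hint (fun i j hij => hind.indepFun hij) hident
  rw [hE] at hslln
  set E := ∫ k : ℕ, (k : ℝ) ∂ν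
  have htm := tendstoInMeasure_of_tendsto_ae (μ := P)
    (f := fun n ω => (∑ i ∈ Finset.range n, X i ω) / n) (g := fun _ => E)
    (fun n => ((Finset.measurable_sum _ fun i _ => hmX i).div_const _).aestronglyMeasurable)
    hslln
  rw [tendstoInMeasure_iff_dist] at htm
  have h1 := htm 1 one_pos
  refine tendsto_of_tendsto_of_tendsto_of_le_of_le' tendsto_const_nhds h1
    (Eventually.of_forall fun _ => zero_le) ?_
  filter_upwards [eventually_gt_atTop 0] with n hn
  have hn' : (0 : ℝ) < n := by exact_mod_cast hn
  have hmap : P.map (fun ω (i : Fin n) => ω i) = Measure.pi fun _ : Fin n => ν := by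
    rw [← Measure.infinitePi_eq_pi]
    exact Measure.map_infinitePi_infinitePi_of_inj (P := fun _ : ℕ => ν)
      (f := fun i : Fin n => (i : ℕ)) Fin.val_injective
  rw [← hmap, Measure.map_apply (by fun_prop) (Set.to_countable _).measurableSet]
  refine measure_mono fun ω hω => ?_
  have h2 : n * β < ((∑ i : Fin n, ω i : ℕ) : ℝ) := hω
  rw [Set.mem_ofPred_eq, Real.dist_eq]
  refine le_trans ?_ (le_abs_self _)
  rw [le_sub_iff_add_le, le_div_iff₀ hn', Finset.sum_range]
  push_cast at h2
  have h3 : (1 + E) * n ≤ β * n := by gcongr; linarith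
  change (1 + E) * n ≤ ∑ i : Fin n, ((ω i : ℕ) : ℝ)
  linarith

theorem totalDegree_evenDegrees_le {n : ℕ} (d : Fin n → ℕ) :
    totalDegree (evenDegrees d) ≤ totalDegree d + n := by
  unfold totalDegree
  calc ∑ i, evenDegrees d i ≤ ∑ i, (d i + 1) := Finset.sum_le_sum fun i _ => evenDegrees_le d i
    _ = _ := by simp [Finset.sum_add_distrib]

theorem tendsto_percolatedLaw_totalDegree_gt {ν : Measure ℕ} [IsProbabilityMeasure ν]
    (hν : Integrable (fun k : ℕ => (k : ℝ)) ν) (p : ℕ → unitInterval) {β : ℝ}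
    (hβ : ∫ k : ℕ, (k : ℝ) ∂ν + 2 ≤ β) :
    Tendsto (fun n : ℕ => (percolatedLaw ν p n).toOuterMeasure
      {ω | ¬ (totalDegree ω.1 : ℝ) ≤ n * β}) atTop (𝓝 0) := by
  refine tendsto_of_tendsto_of_tendsto_of_le_of_le tendsto_const_nhds
    (tendsto_pi_sum_gt hν (β := β - 1) (by linarith)) (fun _ => zero_le) fun n => ?_
  refine (toOuterMeasure_bind_le _ _ {d | (totalDegree (evenDegrees d) : ℝ) ≤ n * β} _ 0
    fun d hd => ?_).trans ?_
  · refine (toOuterMeasure_bind_le _ _ Set.univ _ 0 fun keep _ => ?_).trans (by simp)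
    rw [PMF.toOuterMeasure_map_apply, nonpos_iff_eq_zero]
    exact measure_mono_null (t := ∅) (fun σ hσ => hσ hd) measure_empty
  · rw [add_zero, iidDegrees, toPMF_toOuterMeasure]
    refine measure_mono fun d hd => ?_
    rw [Set.mem_compl_iff, Set.mem_ofPred_eq, not_le] at hd
    have h : (totalDegree (evenDegrees d) : ℝ) ≤ totalDegree d + n := by
      exact_mod_cast totalDegree_evenDegrees_le d
    rw [Set.mem_ofPred_eq]
    linarith

/-! ### Choice of the degree window at each scale. -/

theorem real_Ioc_floor (ν : Measure ℕ) [IsProbabilityMeasure ν] {y z : ℝ} (hy : 0 ≤ y)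
    (hyz : y ≤ z) : ν.real (Set.Ioc ⌊y⌋₊ ⌊z⌋₊) = (1 - degreeCDF ν y) - (1 - degreeCDF ν z) := by
  rw [one_sub_degreeCDF, one_sub_degreeCDF,
    ← measureReal_sdiff (s₁ := {k : ℕ | y < k}) (s₂ := {k : ℕ | z < k})
      (fun k (hk : z < k) => hyz.trans_lt hk) (Set.to_countable _).measurableSet]
  congr 1
  ext k
  simp [Nat.floor_lt hy, Nat.le_floor_iff (hy.trans hyz)]

theorem rpow_le_two_mul_rpow {u s κ : ℝ} (hu : 0 ≤ u) (hus : u ≤ 2 * s) (hs : 0 ≤ s)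
    (hκ : 0 ≤ κ) (hκ1 : κ ≤ 1) : u ^ κ ≤ 2 * s ^ κ := by
  calc u ^ κ ≤ (2 * s) ^ κ := Real.rpow_le_rpow hu hus hκ
    _ = 2 ^ κ * s ^ κ := Real.mul_rpow (by norm_num) hs
    _ ≤ 2 * s ^ κ := by
      gcongr
      calc (2 : ℝ) ^ κ ≤ 2 ^ (1 : ℝ) := Real.rpow_le_rpow_of_exponent_le (by norm_num) hκ1
        _ = 2 := Real.rpow_one _

theorem exp_rpow_add_mul_log_rpow {s : ℝ} (hs : 0 < s) (a C κ : ℝ) :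
    Real.exp s ^ (a + C * s ^ (κ - 1)) = Real.exp (a * s + C * s ^ κ) := by
  rw [← Real.exp_mul]
  congr 1
  rw [Real.rpow_sub_one hs.ne']
  field_simp

theorem eventually_const_mul_rpow_le {κ : ℝ} (hκ : κ < 1) (K : ℝ) {ε : ℝ} (hε : 0 < ε) :
    ∀ᶠ k : ℕ in atTop, K * (k : ℝ) ^ κ ≤ ε * k := by
  have h := (tendsto_rpow_neg_atTop (y := 1 - κ) (by linarith)).const_mul K
  rw [mul_zero] at h
  filter_upwards [tendsto_natCast_atTop_atTop.eventually (h.eventually_le_const hε),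
    eventually_gt_atTop 0] with k hk hk0
  have hk0' : (0 : ℝ) < k := by exact_mod_cast hk0
  rw [neg_sub, Real.rpow_sub_one hk0'.ne', ← mul_div_assoc, div_le_iff₀ hk0'] at hk
  exact hk

theorem PowerLaw.exists_scales {ν : Measure ℕ} [IsProbabilityMeasure ν] {τ γ C : ℝ}
    (hτ : 2 < τ) (hγ : γ ∈ Set.Ioo (0 : ℝ) 1) (hC : 0 < C)
    (hF : PowerLaw (degreeCDF ν) τ γ C) {p : ℕ → unitInterval} {b c γ' : ℝ} (hb : 0 < b)
    (hc : 0 < c) (hγ' : γ' < 1)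
    (hpb : ∀ d : ℕ, 2 ≤ d → b * Real.exp (-c * Real.log d ^ γ') < p d) (m : ℕ) {K η : ℝ}
    (hK : 0 < K) (hη : 0 < η) :
    ∃ D : ℝ, 0 < D ∧ ∃ k₀ : ℕ, ∀ k : ℕ, k₀ ≤ k → ∃ Y M : ℕ, m + 1 ≤ Y ∧
      0 < ν.real (Set.Ioc Y M) ∧ 0 < (p (M + 1) : ℝ) ∧
      Real.exp k ≤ Y * p (M + 1) * K ∧
      1 / 8 * Real.exp (-((τ - 1) * k + D * (k : ℝ) ^ max γ γ'))
        ≤ Real.exp k * ν.real (Set.Ioc Y M) / (2 * (M + 1)) ∧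
      b / 2 * Real.exp (-((τ - 1 + η) * k)) ≤ ν.real (Set.Ioc Y M) * p (M + 1) := by
  set κ := max γ γ' with hκ
  have hκ0 : 0 < κ := hγ.1.trans_le (le_max_left _ _)
  have hκ1 : κ < 1 := max_lt hγ.2 hγ'
  obtain ⟨X₀, hX₀⟩ := eventually_atTop.mp hF
  -- The window is `(exp (s + A t), exp (s + A' t)]` with `t = s ^ κ`. In `A`, the part `2 * c` pays
  -- for the retention bound `b * exp (-(2 * c * t))` and the 1 for the constants `b`, `K`. In `A'`,
  -- the part `4 * C` covers the corrections `2 * C * t` in the two tail bounds, and the 1 makes the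
  -- tail at `z` at most half the lower bound at `y`.
  set A := 2 * c + 1 with hA
  set A' := A + 4 * C + 1 with hA'
  have hτ1 : 0 < τ - 1 := by linarith
  refine ⟨(τ - 1) * A + 2 * C + A', by positivity, ?_⟩
  have htend : Tendsto (fun k : ℕ => (k : ℝ) ^ κ) atTop atTop :=
    (tendsto_rpow_atTop hκ0).comp tendsto_natCast_atTop_atTop
  obtain ⟨k₀, hk₀⟩ := eventually_atTop.mp
    ((eventually_ge_atTop 1).and ((tendsto_natCast_atTop_atTop.eventually_ge_atTop X₀).and
      ((eventually_ge_atTop (m + 1)).and ((htend.eventually_ge_atTop 1).and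
      ((htend.eventually_ge_atTop (2 / (b * K))).and
      ((eventually_const_mul_rpow_le hκ1 (A' + 1) one_pos).and
      (eventually_const_mul_rpow_le hκ1 ((τ - 1) * A + 2 * C + 2 * c) hη)))))))
  refine ⟨k₀, fun k hk => ?_⟩
  obtain ⟨hk1, hkX, hkm, ht1, htK, htA, htη⟩ := hk₀ k hk
  set s : ℝ := (k : ℝ) with hs
  set t : ℝ := s ^ κ with ht
  have hs1 : 1 ≤ s := by rw [hs]; exact_mod_cast hk1
  have hA0 : 0 < A := by positivity
  have hA'0 : 0 < A' := by positivity
  have htA' : A' * t + 1 ≤ s := by linarith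
  have hAA' : A * t ≤ A' * t := by gcongr; linarith
  have hAt : 0 < A * t := by positivity
  set y := Real.exp (s + A * t) with hy
  set z := Real.exp (s + A' * t) with hz
  have hsexp : s + 1 ≤ Real.exp s := Real.add_one_le_exp s
  have hsy : Real.exp s ≤ y := Real.exp_le_exp.mpr (by linarith)
  have hyz : y ≤ z := Real.exp_le_exp.mpr (by linarith)
  have hkm' : (m : ℝ) + 1 ≤ s := by rw [hs]; exact_mod_cast hkm
  -- Every logarithm that occurs lies in `[s, 2 * s]`, so both corrections, with `γ` and with `γ'`,
  -- are multiples of the same `t`.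
  have hpow : ∀ u : ℝ, s ≤ u → u ≤ 2 * s → ∀ g ≤ κ, u ^ g ≤ 2 * t := fun u hu1 hu2 g hg =>
    (Real.rpow_le_rpow_of_exponent_le (by linarith) hg).trans
      (rpow_le_two_mul_rpow (by linarith) hu2 (by linarith) hκ0.le hκ1.le)
  have hlow : Real.exp (-((τ - 1) * (s + A * t) + 2 * C * t)) ≤ 1 - degreeCDF ν y := by
    refine le_trans ?_ (hX₀ y (by linarith)).1
    have hu : 0 < s + A * t := by linarith
    rw [hy, Real.log_exp, show -τ + 1 - C * (s + A * t) ^ (γ - 1)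
      = -τ + 1 + (-C) * (s + A * t) ^ (γ - 1) by ring, exp_rpow_add_mul_log_rpow hu]
    refine Real.exp_le_exp.mpr ?_
    have := mul_le_mul_of_nonneg_left
      (hpow (s + A * t) (by linarith) (by linarith) γ (le_max_left _ _)) hC.le
    linarith
  have hupp : 1 - degreeCDF ν z ≤ Real.exp (-((τ - 1) * (s + A * t) + 2 * C * t)) / 2 := by
    refine (hX₀ z (by linarith)).2.trans ?_
    have hu : 0 < s + A' * t := by linarith
    rw [hz, Real.log_exp, exp_rpow_add_mul_log_rpow hu]
    have h1 := mul_le_mul_of_nonneg_left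
      (hpow (s + A' * t) (by linarith) (by linarith) γ (le_max_left _ _)) hC.le
    have h2 : (4 * C + 1) * t ≤ (τ - 1) * ((4 * C + 1) * t) :=
      le_mul_of_one_le_left (by positivity) (by linarith)
    have h3 : (-τ + 1) * (s + A' * t) + C * (s + A' * t) ^ γ
        ≤ -((τ - 1) * (s + A * t) + 2 * C * t) + -1 := by
      rw [hA']; linarith
    refine (Real.exp_le_exp.mpr h3).trans ?_
    rw [Real.exp_add, div_eq_mul_inv]
    gcongr
    rw [Real.exp_neg]
    gcongr
    linarith [Real.add_one_le_exp (1 : ℝ)]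
  have hq : Real.exp (-((τ - 1) * (s + A * t) + 2 * C * t)) / 2
      ≤ ν.real (Set.Ioc ⌊y⌋₊ ⌊z⌋₊) := by
    rw [real_Ioc_floor ν (Real.exp_pos _).le hyz]
    linarith
  set q := ν.real (Set.Ioc ⌊y⌋₊ ⌊z⌋₊)
  have hM1 : (⌊z⌋₊ : ℝ) + 1 ≤ 2 * z := by
    linarith [Nat.floor_le (Real.exp_pos (s + A' * t)).le]
  have hM2 : z < (⌊z⌋₊ : ℝ) + 1 := Nat.lt_floor_add_one z
  have hφ : b * Real.exp (-(2 * c * t)) ≤ p (⌊z⌋₊ + 1) := by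
    refine le_trans ?_ (hpb (⌊z⌋₊ + 1) ?_).le
    · gcongr
      push_cast
      have h1 : s ≤ Real.log (⌊z⌋₊ + 1) := by
        rw [Real.le_log_iff_exp_le (by linarith)]
        linarith
      have h2 : Real.log (⌊z⌋₊ + 1) ≤ 2 * s := by
        refine (Real.log_le_log (by linarith) hM1).trans ?_
        rw [Real.log_mul (by norm_num) (by positivity), hz, Real.log_exp]
        linarith [Real.log_two_lt_d9]
      have := mul_le_mul_of_nonneg_left (hpow _ h1 h2 γ' (le_max_right _ _)) hc.le
      linarith
    · have : (2 : ℝ) ≤ z := by linarith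
      have : 2 ≤ ⌊z⌋₊ := Nat.le_floor (by exact_mod_cast this)
      omega
  have hφ0 : 0 < (p (⌊z⌋₊ + 1) : ℝ) := lt_of_lt_of_le (by positivity) hφ
  have hY : y / 2 ≤ ⌊y⌋₊ := by
    have := Nat.lt_floor_add_one y
    linarith
  refine ⟨⌊y⌋₊, ⌊z⌋₊, ?_, lt_of_lt_of_le (by positivity) hq, hφ0, ?_, ?_, ?_⟩
  · refine Nat.le_floor ?_
    push_cast
    linarith
  · have h1 : 2 ≤ b * K * Real.exp t := by
      rw [div_le_iff₀ (by positivity)] at htK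
      have : b * K * t ≤ b * K * Real.exp t := by
        gcongr
        linarith [Real.add_one_le_exp t]
      linarith
    calc Real.exp s ≤ Real.exp s * (b * K * Real.exp t / 2) :=
          le_mul_of_one_le_right (Real.exp_pos _).le (by linarith)
      _ = y / 2 * (b * Real.exp (-(2 * c * t))) * K := by
          have : y = Real.exp s * Real.exp t * Real.exp (2 * c * t) := by
            rw [hy, ← Real.exp_add, ← Real.exp_add, hA]
            ring_nf
          rw [this, Real.exp_neg]
          field_simp
      _ ≤ _ := by gcongr
  · calc 1 / 8 * Real.exp (-((τ - 1) * s + ((τ - 1) * A + 2 * C + A') * t))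
        = Real.exp s * (Real.exp (-((τ - 1) * (s + A * t) + 2 * C * t)) / 2) / (2 * (2 * z)) := by
          have : Real.exp (-((τ - 1) * s + ((τ - 1) * A + 2 * C + A') * t)) * z
              = Real.exp s * Real.exp (-((τ - 1) * (s + A * t) + 2 * C * t)) := by
            rw [hz, ← Real.exp_add, ← Real.exp_add]
            ring_nf
          rw [eq_div_iff (by positivity)]
          linear_combination (1 / 2) * this
      _ ≤ _ := by gcongr
  · calc b / 2 * Real.exp (-((τ - 1 + η) * s))
        ≤ b / 2 * Real.exp (-((τ - 1) * (s + A * t) + 2 * C * t) + -(2 * c * t)) := by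
          gcongr
          linarith
      _ = Real.exp (-((τ - 1) * (s + A * t) + 2 * C * t)) / 2 * (b * Real.exp (-(2 * c * t))) := by
          rw [Real.exp_add]; ring
      _ ≤ _ := by gcongr

/-! ### From single scales to all thresholds. -/

theorem exists_real_Icc_pos (ν : Measure ℕ) [IsProbabilityMeasure ν] (h1 : degreeCDF ν 1 = 0) :
    ∃ m : ℕ, 1 ≤ m ∧ 0 < ν.real (Set.Icc 1 m) := by
  by_contra! h
  have h0 : ∀ m : ℕ, ν (Set.Icc 1 m) = 0 := by
    intro m
    rcases Nat.eq_zero_or_pos m with rfl | hm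
    · simp
    · have := (h m hm).antisymm measureReal_nonneg
      rwa [measureReal_eq_zero_iff] at this
  rw [degreeCDF, measureReal_eq_zero_iff] at h1
  have h2 : ν Set.univ = 0 := by
    refine measure_mono_null (t := {k : ℕ | (k : ℝ) ≤ 1} ∪ ⋃ m : ℕ, Set.Icc 1 m) ?_
      (measure_union_null h1 (measure_iUnion_null h0))
    intro k _
    rcases Nat.eq_zero_or_pos k with rfl | hk
    · left; simp
    · right
      exact Set.mem_iUnion.mpr ⟨k, hk, le_rfl⟩
  simp at h2

theorem one_sub_empiricalCDF {n : ℕ} (hn : 0 < n) (d : Fin n → ℕ) (x : ℝ) :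
    1 - empiricalCDF d x = ((Finset.univ.filter fun i => x < d i).card : ℝ) / n := by
  have hn' : (0 : ℝ) < n := by exact_mod_cast hn
  have h := Finset.card_filter_add_card_filter_not (s := (Finset.univ : Finset (Fin n)))
    (fun i => (d i : ℝ) ≤ x)
  simp only [not_le, Finset.card_univ, Fintype.card_fin] at h
  have h' : ((Finset.univ.filter fun i => (d i : ℝ) ≤ x).card : ℝ)
      + (Finset.univ.filter fun i => x < d i).card = n := by exact_mod_cast h
  rw [empiricalCDF, eq_div_iff hn'.ne', sub_mul, div_mul_cancel₀ _ hn'.ne']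
  linarith

/-- The tail is monotone, so `x` is rounded up to `exp k` with `k = ⌈log x⌉₊`. This costs `exp (-(τ
- 1)) ≥ exp (-2)`, and `k ≤ 2 * log x` doubles `D`. -/
theorem tail_le_of_exp_grid {n : ℕ} (hn : 0 < n) (d : Fin n → ℕ) {τ κ D α : ℝ}
    (hτ : τ ∈ Set.Ioo (2 : ℝ) 3) (hκ0 : 0 ≤ κ) (hκ1 : κ ≤ 1) (hD : 0 < D) {k₀ : ℕ} (hk₀ : 1 ≤ k₀)
    (h : ∀ k : ℕ, k₀ ≤ k → (k : ℝ) ≤ α * Real.log n + 1 →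
      1 / 8 * Real.exp (-((τ - 1) * k + D * (k : ℝ) ^ κ)) * n
        ≤ (Finset.univ.filter fun i => Real.exp k < d i).card)
    {x : ℝ} (hx : Real.exp k₀ ≤ x) (hxn : x < (n : ℝ) ^ α) :
    Real.exp (-2) / 8 / x ^ (τ - 1 + 2 * D * Real.log x ^ (κ - 1)) ≤ 1 - empiricalCDF d x := by
  have hn' : (0 : ℝ) < n := by exact_mod_cast hn
  have hx0 : 0 < x := (Real.exp_pos _).trans_le hx
  set s := Real.log x with hs
  have hxs : x = Real.exp s := (Real.exp_log hx0).symm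
  have hsk : (k₀ : ℝ) ≤ s := (Real.le_log_iff_exp_le hx0).mpr hx
  have hk₀' : (1 : ℝ) ≤ k₀ := by exact_mod_cast hk₀
  have hs1 : 1 ≤ s := hk₀'.trans hsk
  have hsn : s < α * Real.log n := by
    rw [← Real.log_rpow hn']
    exact Real.log_lt_log hx0 hxn
  set k := ⌈s⌉₊
  have hk1 : s ≤ k := Nat.le_ceil s
  have hk2 : (k : ℝ) < s + 1 := Nat.ceil_lt_add_one (by linarith)
  have hkk : k₀ ≤ k := by
    have : (k₀ : ℝ) ≤ k := hsk.trans hk1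
    exact_mod_cast this
  rw [one_sub_empiricalCDF hn, le_div_iff₀ hn']
  refine le_trans ?_ ((h k hkk (by linarith)).trans ?_)
  · gcongr
    rw [hxs, exp_rpow_add_mul_log_rpow (by linarith), div_eq_mul_inv, ← Real.exp_neg,
      div_mul_eq_mul_div, ← Real.exp_add, one_div_mul_eq_div]
    gcongr
    have h1 := mul_le_mul_of_nonneg_left
      (rpow_le_two_mul_rpow (u := k) (s := s) (κ := κ) (by positivity) (by linarith)
        (by linarith) hκ0 hκ1) hD.le
    have h2 : (τ - 1) * k ≤ (τ - 1) * (s + 1) := by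
      gcongr
      linarith [hτ.1]
    linarith [hτ.2]
  · rw [Nat.cast_le]
    refine Finset.card_le_card fun i hi => ?_
    simp only [Finset.mem_filter, Finset.mem_univ, true_and] at hi ⊢
    rw [hxs]
    exact (Real.exp_le_exp.mpr hk1).trans_lt hi

theorem tendsto_log_mul_rpow_neg {α ε K : ℝ} (hε : 0 < ε) :
    Tendsto (fun n : ℕ => (α * Real.log n + 2) * (K * (n : ℝ) ^ (-ε))) atTop (𝓝 0) := by
  have h1 : Tendsto (fun x : ℝ => Real.log x * x ^ (-ε)) atTop (𝓝 0) := by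
    have := (isLittleO_log_rpow_atTop hε).tendsto_div_nhds_zero
    refine this.congr' ?_
    filter_upwards [eventually_ge_atTop 0] with x hx
    rw [Real.rpow_neg hx, div_eq_mul_inv]
  have h2 := ((h1.const_mul (α * K)).add
    ((tendsto_rpow_neg_atTop hε).const_mul (2 * K))).comp tendsto_natCast_atTop_atTop
  simp only [mul_zero, add_zero] at h2
  refine h2.congr fun n => ?_
  simp only [Function.comp_apply]
  ring

theorem percolatedLaw_iUnion_le (ν : Measure ℕ) [IsProbabilityMeasure ν] (p : ℕ → unitInterval)
    (n : ℕ) {T : ℝ} (hT : 0 ≤ T) (S : ℕ → Set ((Fin n → ℕ) × (Fin n → ℕ))) (k₀ : ℕ) {e : ℝ}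
    (he : 0 ≤ e) (h : ∀ k : ℕ, k₀ ≤ k → (k : ℝ) ≤ T →
      (percolatedLaw ν p n).toOuterMeasure (S k) ≤ ENNReal.ofReal e) :
    (percolatedLaw ν p n).toOuterMeasure {ω | ∃ k : ℕ, k₀ ≤ k ∧ (k : ℝ) ≤ T ∧ ω ∈ S k}
      ≤ ENNReal.ofReal ((T + 1) * e) := by
  have hsub : {ω | ∃ k : ℕ, k₀ ≤ k ∧ (k : ℝ) ≤ T ∧ ω ∈ S k}
      ⊆ ⋃ k ∈ Finset.Icc k₀ ⌊T⌋₊, S k := by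
    rintro ω ⟨k, hk, hkT, hω⟩
    exact Set.mem_biUnion (Finset.mem_Icc.mpr ⟨hk, Nat.le_floor hkT⟩) hω
  refine (measure_mono hsub).trans ((measure_biUnion_finset_le _ _).trans ?_)
  refine (Finset.sum_le_card_nsmul _ _ (ENNReal.ofReal e) fun k hk => ?_).trans ?_
  · rw [Finset.mem_Icc] at hk
    exact h k hk.1 ((Nat.le_floor_iff hT).mp hk.2)
  · rw [nsmul_eq_mul, ← ENNReal.ofReal_natCast, ← ENNReal.ofReal_mul (by positivity)]
    refine ENNReal.ofReal_le_ofReal ?_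
    gcongr
    have h1 : (Finset.Icc k₀ ⌊T⌋₊).card ≤ ⌊T⌋₊ + 1 := by rw [Nat.card_Icc]; omega
    have h2 : ((Finset.Icc k₀ ⌊T⌋₊).card : ℝ) ≤ ⌊T⌋₊ + 1 := by exact_mod_cast h1
    linarith [Nat.floor_le hT]

theorem tendsto_toMeasure_one {Ω : ℕ → Type*} [∀ n, MeasurableSpace (Ω n)]
    [∀ n, DiscreteMeasurableSpace (Ω n)] (P : ∀ n, PMF (Ω n)) (G : ∀ n, Set (Ω n))
    (h : Tendsto (fun n => (P n).toOuterMeasure (G n)ᶜ) atTop (𝓝 0)) :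
    Tendsto (fun n => (P n).toMeasure (G n)) atTop (𝓝 1) := by
  have h2 : Tendsto (fun n => 1 - (P n).toOuterMeasure (G n)ᶜ) atTop (𝓝 (1 - 0)) :=
    ENNReal.Tendsto.sub tendsto_const_nhds h (Or.inl ENNReal.one_ne_top)
  rw [tsub_zero] at h2
  refine h2.congr fun n => ?_
  rw [← PMF.toMeasure_apply_eq_toOuterMeasure_apply _ (MeasurableSet.of_discrete),
    prob_compl_eq_one_sub MeasurableSet.of_discrete]
  exact ENNReal.sub_sub_cancel ENNReal.one_ne_top prob_le_one

end DegreePercolation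

theorem proposition3p4
    (ν : Measure ℕ) [IsProbabilityMeasure ν] (τ γ C : ℝ)
    (hτ : τ ∈ Set.Ioo (2 : ℝ) 3) (hγ : γ ∈ Set.Ioo (0 : ℝ) 1) (hC : 0 < C)
    (hF : DegreePercolation.PowerLaw (DegreePercolation.degreeCDF ν) τ γ C)
    (hF1 : DegreePercolation.degreeCDF ν 1 = 0)
    (p : ℕ → unitInterval) (hp : Antitone p)
    (b c γ' : ℝ) (hb : 0 < b) (hc : 0 < c) (hγ' : γ' < 1)
    (hpb : ∀ d : ℕ, 2 ≤ d → b * Real.exp (-c * Real.log d ^ γ') < p d) :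
    ∃ α : ℝ, 1 / 2 < α ∧ ∃ x₀ : ℝ, 1 < x₀ ∧ ∃ c₁ : ℝ, 0 < c₁ ∧ ∃ C₁ : ℝ, 0 < C₁ ∧
      ∃ β : ℝ, 0 < β ∧
        Tendsto (fun n : ℕ => (DegreePercolation.percolatedLaw ν p n).toMeasure
            {ω | (∀ x : ℝ, x₀ ≤ x → x < (n : ℝ) ^ α →
                  c₁ / x ^ (τ - 1 + C₁ * Real.log x ^ (max γ γ' - 1))
                    ≤ 1 - DegreePercolation.empiricalCDF ω.2 x) ∧
                (DegreePercolation.totalDegree ω.1 : ℝ) ≤ n * β})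
          atTop (𝓝 1) := by
  classical
  set κ := max γ γ'
  have hκ0 : 0 ≤ κ := hγ.1.le.trans (le_max_left _ _)
  have hκ1 : κ ≤ 1 := max_le hγ.2.le hγ'.le
  obtain ⟨m, hm1, hm⟩ := DegreePercolation.exists_real_Icc_pos ν hF1
  have hπ : 0 < (p (m + 1) : ℝ) :=
    lt_trans (by positivity) (hpb (m + 1) (by omega))
  set ρ := ν.real (Set.Icc 1 m) with hρdef
  set π : ℝ := (p (m + 1) : ℝ) with hπdef
  have hint := hF.integrable hτ.1 hγ.2
  set β := ∫ k : ℕ, (k : ℝ) ∂ν + 2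
  have hβ : 0 < β := by
    have : 0 ≤ ∫ k : ℕ, (k : ℝ) ∂ν := integral_nonneg fun k => by positivity
    linarith
  set θ := 3 - τ
  have hθ0 : 0 < θ := by linarith [hτ.2]
  have hθ1 : θ < 1 := by linarith [hτ.1]
  obtain ⟨D, hD, k₀, hk₀⟩ := hF.exists_scales hτ.1 hγ hC hb hc hγ' hpb m
    (K := ρ * π / (32 * β)) (η := θ / 2) (by positivity) (by positivity)
  -- With `η = θ / 2` the failure exponent `τ - 1 + η` is `2 - θ / 2`. Since `2 - θ / 4` lies
  -- strictly between this and 2, both `α > 1/2` and `(2 - θ / 2) * α < 1` hold.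
  set α := 1 / (2 - θ / 4) with hα
  have hα0 : 0 < α := by
    rw [hα]
    apply one_div_pos.mpr
    linarith
  set ε := 1 - (2 - θ / 2) * α with hε
  have hε0 : 0 < ε := by
    rw [hε, hα, mul_one_div, sub_pos, div_lt_one (by linarith)]
    linarith
  set k₁ := max k₀ 1
  refine ⟨α, ?_, Real.exp k₁, ?_, Real.exp (-2) / 8, by positivity, 2 * D, by positivity, β, hβ, ?_⟩
  · rw [hα]
    gcongr <;> linarith
  · rw [Real.one_lt_exp_iff]
    have : 1 ≤ k₁ := le_max_right _ _
    exact_mod_cast this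
  set K := (72 + 64 * β) / (b / 2 * Real.exp (-(2 - θ / 2)) * ρ * π) with hK
  have hK0 : 0 < K := by positivity
  refine DegreePercolation.tendsto_toMeasure_one _ _ ?_
  have hlim := (DegreePercolation.tendsto_percolatedLaw_totalDegree_gt hint p le_rfl).add
    (ENNReal.tendsto_ofReal (DegreePercolation.tendsto_log_mul_rpow_neg (α := α) (K := K) hε0))
  rw [ENNReal.ofReal_zero, add_zero] at hlim
  refine tendsto_of_tendsto_of_tendsto_of_le_of_le' tendsto_const_nhds hlim
    (Eventually.of_forall fun _ => zero_le) ?_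
  filter_upwards [eventually_ge_atTop 1] with n hn
  have hn' : (1 : ℝ) ≤ n := by exact_mod_cast hn
  have hlog : 0 ≤ Real.log n := Real.log_nonneg hn'
  let S : ℕ → Set ((Fin n → ℕ) × (Fin n → ℕ)) := fun k =>
    {ω | (DegreePercolation.totalDegree ω.1 : ℝ) ≤ n * β ∧
      ((Finset.univ.filter fun i => Real.exp k < ω.2 i).card : ℝ)
        < 1 / 8 * Real.exp (-((τ - 1) * k + D * (k : ℝ) ^ κ)) * n}
  -- The `+ 1` in `T` is needed because `log x < α * log n` is rounded up.
  have hS := DegreePercolation.percolatedLaw_iUnion_le ν p n (T := α * Real.log n + 1)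
    (by positivity) S k₁ (e := K * (n : ℝ) ^ (-ε)) (by positivity) (by
      intro k hk hkT
      obtain ⟨Y, M, hmY, hq0, hφ0, hxY, hlow, hqφ⟩ := hk₀ k ((le_max_left _ _).trans hk)
      have key := DegreePercolation.percolatedLaw_card_lt_le ν hp (n := n) (M := M)
        (x := Real.exp k) hn hmY hβ hρdef.symm hm hπdef.symm hπ rfl hq0 rfl hφ0
        (Real.exp_pos _).le (hxY.trans_eq (by ring))
      have hle : 1 / 8 * Real.exp (-((τ - 1) * k + D * (k : ℝ) ^ κ)) * n
          ≤ Real.exp k * n * ν.real (Set.Ioc Y M) / (2 * (M + 1)) := by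
        calc _ ≤ Real.exp k * ν.real (Set.Ioc Y M) / (2 * (M + 1)) * n := by gcongr
          _ = _ := by ring
      refine le_trans (measure_mono fun ω (hω : ω ∈ S k) => ?_)
        (key.trans (ENNReal.ofReal_le_ofReal ?_))
      · exact ⟨hω.1, hω.2.trans_le hle⟩
      · have hnε : b / 2 * Real.exp (-(2 - θ / 2)) * (n : ℝ) ^ ε
            ≤ n * (ν.real (Set.Ioc Y M) * p (M + 1)) := by
          have hn0 : (0 : ℝ) < n := by linarith
          calc b / 2 * Real.exp (-(2 - θ / 2)) * (n : ℝ) ^ ε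
              = n * (b / 2 * Real.exp (-((2 - θ / 2) * (α * Real.log n + 1)))) := by
                rw [hε, Real.rpow_sub hn0, Real.rpow_one, Real.rpow_def_of_pos hn0,
                  show -((2 - θ / 2) * (α * Real.log n + 1))
                    = -(2 - θ / 2) + -(Real.log n * ((2 - θ / 2) * α)) by ring,
                  Real.exp_add, Real.exp_neg (Real.log n * _)]
                ring
            _ ≤ n * (b / 2 * Real.exp (-((τ - 1 + θ / 2) * k))) := by
                gcongr
                · linarith
                · linarith
            _ ≤ _ := by gcongr
        calc _ = (72 + 64 * β) / (n * (ν.real (Set.Ioc Y M) * p (M + 1)) * ρ * π) := by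
              ring_nf
          _ ≤ (72 + 64 * β) / (b / 2 * Real.exp (-(2 - θ / 2)) * (n : ℝ) ^ ε * ρ * π) := by
              gcongr
          _ = _ := by
              rw [hK, Real.rpow_neg (by positivity)]
              field_simp)
  rw [add_assoc, one_add_one_eq_two] at hS
  refine le_trans (measure_mono ?_) ((measure_union_le _ _).trans (add_le_add le_rfl hS))
  intro ω hω
  by_contra hcon
  rw [Set.mem_union, not_or] at hcon
  obtain ⟨h1, h2⟩ := hcon
  have h1' : (DegreePercolation.totalDegree ω.1 : ℝ) ≤ n * β := not_not.mp h1
  refine hω ⟨fun x hx hxn => ?_, h1'⟩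
  refine DegreePercolation.tail_le_of_exp_grid hn ω.2 hτ hκ0 hκ1 hD (le_max_right k₀ 1)
    (fun k hk hkT => ?_) hx hxn
  by_contra! hlt
  exact h2 ⟨k, hk, hkT, h1', hlt⟩
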